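/- Let $(L,R)$ be a random vector of non-negative random variables and let $0<\alpha<1<p$ be such that $$P\{L>0\}+P\{R>0\}>1,\qquad E[L^\alpha+R^\alpha]=1,\qquad E[L^p+R^p]<1 .$$ For $q>0$ put $S(q)=E[L^q+R^q]-1\in[-1,\infty]$, $\varphi(q)=S(q)/q$, and for $q\ge 1$ put $K_1(q)=\max\{\varphi(1),\varphi(q)\}$. Let $\bar\mu_0$ be a probability measure on $\mathbb R$ whose distribution function $F_0$ satisfies, for some real numbers $c_0^+,c_0^-$, $$\lim_{x\to+\infty}x^\alpha(1-F_0(x))=c_0^+,\qquad \lim_{x\to-\infty}|x|^\alpha F_0(x)=c_0^- ,$$ and put $$\lambda=\frac{(c_0^++c_0^-)\pi}{2\Gamma(\alpha)\sin(\pi\alpha/2)},\qquad \beta=\frac{c_0^+-c_0^-}{c_0^++c_0^-}\quad(\beta=0\text{ if }c_0^++c_0^-=0).$$ Let $(\mu_t)_{t\ge0}$ be the solution of $\partial_t\mu_t+\mu_t=Q^+(\mu_t,\mu_t)$ with initial datum $\bar\mu_0$, that is, the family of probability measures on $\mathbb R$ with $\mu_0=\bar\mu_0$ whose characteristic functions $\hat\mu_t(\xi)=\int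 e^{i\xi v}\mu_t(dv)$ satisfy $$\partial_t\hat\mu_t(\xi)+\hat\mu_t(\xi)=E[\hat\mu_t(L\xi)\hat\mu_t(R\xi)]\qquad(t>0,\ \xi\in\mathbb R)$$ and are continuous in $t$ at $t=0$ for each $\xi$. Let $\mu_\infty$ be the corresponding steady state, that is, the probability measure with $$\int_{\mathbb R}e^{i\xi v}\mu_\infty(dv)=\int_{[0,\infty)}e^{-\lambda m|\xi|^\alpha\left[1-i\beta\tan(\pi\alpha/2)\operatorname{sign}\xi\right]}\nu_\alpha(dm)\qquad(\xi\in\mathbb R),$$ where $\nu_\alpha$ is the probability measure on $[0,\infty)$ with mean $1$ and $\hat\nu_\alpha(\xi)=E[\hat\nu_\alpha(L^\alpha\xi)\hat\nu_\alpha(R^\alpha\xi)]$ for all $\xi\in\mathbb R$. Let $$d_p(\mu_1,\mu_2)=\inf_m\Big(\int_{\mathbb R^2}|x-y|^p\,m(dx\,dy)\Big)^{\min\{1,1/p\}}\in[0,\infty]$$ be the Wasserstein distance of order $p$, the infimum being over all probability measures $m$ on $\mathbb R^2$ with marginals $\mu_1$ and $\mu_2$. If $d_p(\bar\mu_0,\mu_\infty)<\infty$,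 then there is a constant $0<C_p<\infty$, not depending on $t$, such that for every $t\ge0$ $$d_p(\mu_t,\mu_\infty)\le\begin{cases}C_p\,e^{-t|K_1(p)|}&\text{if }\varphi(p)\ne\varphi(1),\\ C_p\,\max\{1,t\}\,e^{-t|K_1(p)|}&\text{if }\varphi(p)=\varphi(1).\end{cases}$$ -/

import Mathlib

open MeasureTheory ProbabilityTheory Filter Topology
open scoped ENNReal NNReal

noncomputable section

namespace GenKac

variable {Ω : Type*} [MeasurableSpace Ω]

/-- The power `x ^ s` of a non-negative real, with the convention `0 ^ 0 = 0`. -/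
def power (x s : ℝ) : ℝ := if x = 0 then 0 else x ^ s

/-- `E[L ^ s + R ^ s]`, as an element of `[0, ∞]`. -/
def powerMoment (P : Measure Ω) (L R : Ω → ℝ) (s : ℝ) : ℝ≥0∞ :=
  ∫⁻ ω, ENNReal.ofReal (power (L ω) s + power (R ω) s) ∂P

/-- `S(s) = E[L ^ s + R ^ s] - 1`, with values in `[-1, ∞]`. -/
def spectralS (P : Measure Ω) (L R : Ω → ℝ) (s : ℝ) : EReal :=
  (powerMoment P L R s : EReal) - 1

/-- The spectral function `φ(q) = S(q) / q`, for `q > 0`. -/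
def spectralPhi (P : Measure Ω) (L R : Ω → ℝ) (q : ℝ) : EReal :=
  spectralS P L R q / (q : EReal)

/-- `K₁(q) = max {φ(1), φ(q)}`, for `q ≥ 1`. -/
def K₁ (P : Measure Ω) (L R : Ω → ℝ) (q : ℝ) : EReal :=
  max (spectralPhi P L R 1) (spectralPhi P L R q)

/-- The standing assumption `(H₀)` on the random vector `(L, R)` with exponents `α` and `p`. -/
structure AssumptionH0 (P : Measure Ω) (L R : Ω → ℝ) (α p : ℝ) : Prop where
  measurable_left : Measurable L
  measurable_right : Measurable R
  nonneg_left : ∀ᵐ ω ∂P, 0 ≤ L ω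
  nonneg_right : ∀ᵐ ω ∂P, 0 ≤ R ω
  one_lt_prob : 1 < P {ω | 0 < L ω} + P {ω | 0 < R ω}
  alpha_pos : 0 < α
  alpha_le_two : α ≤ 2
  p_pos : 0 < p
  moment_alpha : powerMoment P L R α = 1
  moment_p : powerMoment P L R p < 1

/-- The bilinear operator `(f, g) ↦ E[f(L ξ) g(R ξ)]` on characteristic functions. -/
def gainHat (P : Measure Ω) (L R : Ω → ℝ) (f g : ℝ → ℂ) (ξ : ℝ) : ℂ :=
  ∫ ω, f (L ω * ξ) * g (R ω * ξ) ∂P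

/-- `(μ_t)_{t ≥ 0}` is a weak solution of `∂_t μ_t + μ_t = Q⁺(μ_t, μ_t)` with initial datum `μ₀`:
the characteristic functions satisfy, for every `ξ`, the differential equation for `t > 0`; they
take the initial value at `t = 0` and attain it continuously. The values `μ t` for `t < 0` play
no role. -/
structure IsWeakSolution (P : Measure Ω) (L R : Ω → ℝ) (μ₀ : Measure ℝ)
    (μ : ℝ → Measure ℝ) : Prop where
  isProbabilityMeasure : ∀ t : ℝ, 0 ≤ t → IsProbabilityMeasure (μ t)
  initial : μ 0 = μ₀
  continuous_zero : ∀ ξ : ℝ,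
    ContinuousWithinAt (fun t : ℝ => charFun (μ t) ξ) (Set.Ici 0) 0
  equation : ∀ t : ℝ, 0 < t → ∀ ξ : ℝ,
    HasDerivAt (fun s : ℝ => charFun (μ s) ξ)
      (gainHat P L R (charFun (μ t)) (charFun (μ t)) ξ - charFun (μ t) ξ) t

/-- `ν` is a probability measure on `[0, ∞)` with mean `1` that is a fixed point of
`law(M) ↦ law(L ^ α M₁ + R ^ α M₂)`, where `M₁, M₂` are copies of `M` and `M₁, M₂, (L, R)` are
independent (written with characteristic functions). -/
structure IsMixingLaw (P : Measure Ω) (L R : Ω → ℝ) (α : ℝ) (ν : Measure ℝ) : Prop where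
  isProbabilityMeasure : IsProbabilityMeasure ν
  nonneg : ν (Set.Iio 0) = 0
  integrable : Integrable (fun v : ℝ => v) ν
  mean : ∫ v, v ∂ν = 1
  fixed : ∀ ξ : ℝ,
    charFun ν ξ = ∫ ω, charFun ν (power (L ω) α * ξ) * charFun ν (power (R ω) α * ξ) ∂P

/-- The distribution function of `μ₀` has tails of order `α` with constants `c⁺`, `c⁻`:
`x ^ α (1 - F₀(x)) → c⁺` as `x → +∞` and `|x| ^ α F₀(x) → c⁻` as `x → -∞`. -/
def HasTails (μ₀ : Measure ℝ) (α cplus cminus : ℝ) : Prop :=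
  Tendsto (fun x : ℝ => x ^ α * (1 - cdf μ₀ x)) atTop (𝓝 cplus) ∧
  Tendsto (fun x : ℝ => |x| ^ α * cdf μ₀ x) atBot (𝓝 cminus)

/-- The scale parameter `λ` of the stable law attached to the tail constants. -/
def stableScale (α cplus cminus : ℝ) : ℝ :=
  (cplus + cminus) * Real.pi / (2 * Real.Gamma α * Real.sin (Real.pi * α / 2))

/-- The skewness parameter `β` of the stable law attached to the tail constants. -/
def stableSkewness (cplus cminus : ℝ) : ℝ :=
  if cplus + cminus = 0 then 0 else (cplus - cminus) / (cplus + cminus)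

/-- `μinf` is the steady state attached to `(L, R)`, to the exponent `α ∈ (0,1) ∪ (1,2)` and to the
tail constants `c⁺`, `c⁻` of the initial datum: the mixture of `α`-stable laws with
characteristic function
`∫ exp (-λ m |ξ| ^ α (1 - i β tan (π α / 2) sign ξ)) ν(dm)`, where `ν` is the mixing law. -/
def IsSteadyState (P : Measure Ω) (L R : Ω → ℝ) (α cplus cminus : ℝ)
    (μinf : Measure ℝ) : Prop :=
  IsProbabilityMeasure μinf ∧
  ∃ ν : Measure ℝ, IsMixingLaw P L R α ν ∧ ∀ ξ : ℝ,
    charFun μinf ξ = ∫ m : ℝ, Complex.exp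
      (-((stableScale α cplus cminus * m * |ξ| ^ α : ℝ) : ℂ) *
        (1 - Complex.I * ((stableSkewness cplus cminus * Real.tan (Real.pi * α / 2) *
          Real.sign ξ : ℝ) : ℂ))) ∂ν

/-- The Kantorovich-Wasserstein distance of order `p > 0`, with values in `[0, ∞]`:
the infimum of `(∫ |x - y| ^ p dm) ^ (1 ∧ 1/p)` over the couplings `m` of `μ₁` and `μ₂`. -/
def wasserstein (p : ℝ) (μ₁ μ₂ : Measure ℝ) : ℝ≥0∞ :=
  ⨅ m ∈ {m : Measure (ℝ × ℝ) | IsProbabilityMeasure m ∧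
      m.map Prod.fst = μ₁ ∧ m.map Prod.snd = μ₂},
    (∫⁻ z, ENNReal.ofReal (|z.1 - z.2| ^ p) ∂m) ^ (min 1 (1 / p))

end GenKac

end

/-! The proof couples the two solutions along the whole evolution. Since the initial distance is
finite, some coupling `m` of the initial datum and the steady state has finite cost of order `p`; it
need not be optimal. The Wild expansion is run in the plane from `m`, with the same `(L, R)` acting
on both coordinates. Its marginals are weak solutions (`isWeakSolution_map_wildFlow`), one started
from the initial datum, the other from the steady state. By uniqueness (`IsWeakSolution.unique`) the
first is the given solution, and by stationarity (`IsSteadyState.isWeakSolution`) the second stays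
at the steady state. So the flow at time `t` couples the two laws, and its cost bounds the distance.

The cost is the moment of order `p` of `|x - y|`, where `x - y` is linear and evolves by the same
collisions. With `m₁` its first absolute moment and `m` the one of order `p`, the triangle
inequality gives `m₁' ≤ S(1) m₁`, and a sharp expansion of `(a + b) ^ p` gives `m' ≤ S(p) m + K m₁ m
^ (1 - 1/p)`. Taking the root of order `p` makes the latter linear with rate `φ(p)`, forced by a
term of rate `φ(1) = S(1)`. Gronwall's inequality yields the larger rate, with a factor `t` at
resonance (`exists_rpow_inv_le`).

Both rates are negative: `S(p) < 0` is assumed, and `S(1) < 0` follows by interpolation between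
`S(α) = 0` and `S(p)`, as `α < 1 < p`. The first moment thus decays without any centring. -/

noncomputable section

namespace GenKac

set_option linter.unusedSectionVars false

variable {Ω : Type*} [MeasurableSpace Ω]

/-! ### Power series with coefficients of polynomial growth -/

section PowerSeries

variable {F : Type*} [NormedAddCommGroup F] [NormedSpace ℝ F] [CompleteSpace F]

theorem summable_succ_pow_mul_geometric (k : ℕ) {r : ℝ} (h0 : 0 < r) (h1 : r < 1) :
    Summable fun n : ℕ => ((n : ℝ) + 1) ^ k * r ^ n := by
  have h : Summable fun n : ℕ => (n : ℝ) ^ k * r ^ n :=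
    summable_pow_mul_geometric_of_norm_lt_one k (by rwa [Real.norm_eq_abs, abs_of_pos h0])
  have h' := ((summable_nat_add_iff 1).2 h).mul_right r⁻¹
  refine h'.congr fun n => ?_
  push_cast
  field_simp
  ring

theorem summable_smul_of_polynomial_growth {a : ℕ → F} {A : ℝ} {k : ℕ}
    (ha : ∀ n, ‖a n‖ ≤ A * ((n : ℝ) + 1) ^ k) {z : ℝ} (hz : |z| < 1) :
    Summable fun n : ℕ => z ^ n • a n := by
  obtain ⟨r, hr, hr1⟩ := exists_between hz
  have hr0 : 0 < r := (abs_nonneg z).trans_lt hr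
  refine Summable.of_norm_bounded ((summable_succ_pow_mul_geometric k hr0 hr1).mul_left A)
    fun n => ?_
  rw [norm_smul, norm_pow, Real.norm_eq_abs]
  calc |z| ^ n * ‖a n‖ ≤ r ^ n * (A * ((n : ℝ) + 1) ^ k) := by
        gcongr
        exact ha n
    _ = _ := by ring

theorem hasDerivAt_tsum_pow_smul {a : ℕ → F} {A : ℝ} {k : ℕ}
    (ha : ∀ n, ‖a n‖ ≤ A * ((n : ℝ) + 1) ^ k) {z : ℝ} (hz : |z| < 1) :
    HasDerivAt (fun y : ℝ => ∑' n : ℕ, y ^ n • a n)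
      (∑' n : ℕ, (((n : ℝ) + 1) * z ^ n) • a (n + 1)) z := by
  obtain ⟨r, hr, hr1⟩ := exists_between hz
  have hr0 : 0 < r := (abs_nonneg z).trans_lt hr
  have hA : 0 ≤ A := by simpa using (norm_nonneg _).trans (ha 0)
  have hu := ((summable_succ_pow_mul_geometric (k + 1) hr0 hr1).mul_left (A * r⁻¹))
  have hbound : ∀ (n : ℕ), ∀ y ∈ Metric.ball (0 : ℝ) r,
      ‖((n : ℝ) * y ^ (n - 1)) • a n‖ ≤ A * r⁻¹ * (((n : ℝ) + 1) ^ (k + 1) * r ^ n) := by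
    intro n y hy
    rw [mem_ball_zero_iff, Real.norm_eq_abs] at hy
    rcases n with _ | n
    · simp; positivity
    rw [norm_smul, norm_mul, norm_pow, Real.norm_eq_abs, Real.norm_eq_abs, Nat.add_sub_cancel,
      abs_of_nonneg (by positivity)]
    calc ((n + 1 : ℕ) : ℝ) * |y| ^ n * ‖a (n + 1)‖
        ≤ (((n + 1 : ℕ) : ℝ) + 1) * r ^ n * (A * (((n + 1 : ℕ) : ℝ) + 1) ^ k) := by
          gcongr
          · linarith
          · exact ha _
      _ = _ := by field_simp; ring
  have hmem : z ∈ Metric.ball (0 : ℝ) r := by rwa [mem_ball_zero_iff, Real.norm_eq_abs]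
  have key := hasDerivAt_tsum_of_isPreconnected (g := fun (n : ℕ) (y : ℝ) => y ^ n • a n)
    (g' := fun (n : ℕ) (y : ℝ) => ((n : ℝ) * y ^ (n - 1)) • a n) hu Metric.isOpen_ball
    (convex_ball (0 : ℝ) r).isPreconnected
    (fun n y _ => (hasDerivAt_pow n y).smul_const (a n)) hbound
    hmem (summable_smul_of_polynomial_growth ha hz) hmem
  refine key.congr_deriv ?_
  have hs : Summable fun n : ℕ => ((n : ℝ) * z ^ (n - 1)) • a n :=
    Summable.of_norm_bounded hu fun n => hbound n z hmem
  rw [hs.tsum_eq_zero_add]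
  simp

end PowerSeries

/-! ### Uniqueness of weak solutions -/

section Uniqueness

variable {P : Measure Ω} [IsProbabilityMeasure P] {L R : Ω → ℝ}

theorem integrable_gainHat (hL : Measurable L) (hR : Measurable R) (μ : Measure ℝ)
    [IsProbabilityMeasure μ] (ξ : ℝ) :
    Integrable (fun ω => charFun μ (L ω * ξ) * charFun μ (R ω * ξ)) P := by
  have hm : Measurable (charFun μ) := continuous_charFun.measurable
  refine Integrable.of_bound (C := 1) ?_ (.of_forall fun ω => ?_)
  · exact ((hm.comp (hL.mul_const ξ)).mul (hm.comp (hR.mul_const ξ))).aestronglyMeasurable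
  · rw [norm_mul]
    exact mul_le_one₀ (norm_charFun_le_one _) (norm_nonneg _) (norm_charFun_le_one _)

theorem norm_gainHat_sub_le (hL : Measurable L) (hR : Measurable R) (μ ν : Measure ℝ)
    [IsProbabilityMeasure μ] [IsProbabilityMeasure ν] {B : ℝ}
    (hB : ∀ ξ, ‖charFun μ ξ - charFun ν ξ‖ ≤ B) (ξ : ℝ) :
    ‖gainHat P L R (charFun μ) (charFun μ) ξ - gainHat P L R (charFun ν) (charFun ν) ξ‖
      ≤ 2 * B := by
  unfold gainHat
  rw [← integral_sub (integrable_gainHat hL hR μ ξ) (integrable_gainHat hL hR ν ξ)]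
  refine (norm_integral_le_of_norm_le_const (C := 2 * B) (.of_forall fun ω => ?_)).trans
    (by simp)
  have h : charFun μ (L ω * ξ) * charFun μ (R ω * ξ) - charFun ν (L ω * ξ) * charFun ν (R ω * ξ)
      = (charFun μ (L ω * ξ) - charFun ν (L ω * ξ)) * charFun μ (R ω * ξ)
        + charFun ν (L ω * ξ) * (charFun μ (R ω * ξ) - charFun ν (R ω * ξ)) := by ring
  have hB0 : 0 ≤ B := (norm_nonneg _).trans (hB 0)
  calc _ ≤ ‖charFun μ (L ω * ξ) - charFun ν (L ω * ξ)‖ * ‖charFun μ (R ω * ξ)‖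
        + ‖charFun ν (L ω * ξ)‖ * ‖charFun μ (R ω * ξ) - charFun ν (R ω * ξ)‖ := by
        rw [h, ← norm_mul, ← norm_mul]; exact norm_add_le _ _
    _ ≤ B * 1 + 1 * B := by
        gcongr
        · exact hB _
        · exact norm_charFun_le_one _
        · exact norm_charFun_le_one _
        · exact hB _
    _ = 2 * B := by ring

/-- Picard iteration: each integration of the equation gains a factor `3 t / (n + 1)`. The `3` is
the Lipschitz constant `2` of the quadratic gain term in the uniform norm, plus `1` for the loss
term. -/
theorem IsWeakSolution.norm_charFun_sub_le (hL : Measurable L) (hR : Measurable R)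
    {μ₀ : Measure ℝ} {μ ν : ℝ → Measure ℝ} (hμ : IsWeakSolution P L R μ₀ μ)
    (hν : IsWeakSolution P L R μ₀ ν) (n : ℕ) :
    ∀ t : ℝ, 0 ≤ t → ∀ ξ : ℝ,
      ‖charFun (μ t) ξ - charFun (ν t) ξ‖ ≤ 2 * ((3 * t) ^ n / n.factorial) := by
  induction n with
  | zero =>
    intro t ht ξ
    have := hμ.isProbabilityMeasure t ht
    have := hν.isProbabilityMeasure t ht
    calc _ ≤ ‖charFun (μ t) ξ‖ + ‖charFun (ν t) ξ‖ := norm_sub_le _ _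
      _ ≤ 1 + 1 := add_le_add (norm_charFun_le_one _) (norm_charFun_le_one _)
      _ = _ := by norm_num
  | succ n ih =>
    intro t ht ξ
    rcases ht.eq_or_lt with rfl | ht
    · rw [hμ.initial, hν.initial]; simp
    set d : ℝ → ℂ := fun s => charFun (μ s) ξ - charFun (ν s) ξ with hd
    have hderiv : ∀ s : ℝ, 0 < s → HasDerivAt d
        ((gainHat P L R (charFun (μ s)) (charFun (μ s)) ξ - charFun (μ s) ξ)
        - (gainHat P L R (charFun (ν s)) (charFun (ν s)) ξ - charFun (ν s) ξ)) s :=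
      fun s hs => (hμ.equation s hs ξ).sub (hν.equation s hs ξ)
    have hcont0 : Tendsto d (𝓝[>] 0) (𝓝 0) := by
      have h : ContinuousWithinAt d (Set.Ioi 0) 0 :=
        ((hμ.continuous_zero ξ).sub (hν.continuous_zero ξ)).mono Set.Ioi_subset_Ici_self
      have h0 : d 0 = 0 := by rw [hd]; simp only [hμ.initial, hν.initial, sub_self]
      rwa [ContinuousWithinAt, h0] at h
    have hB : ∀ x : ℝ, HasDerivAt (fun s : ℝ => 2 * ((3 * s) ^ (n + 1) / (n + 1).factorial))
        (3 * (2 * ((3 * x) ^ n / n.factorial))) x := by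
      intro x
      have h := ((((hasDerivAt_id x).const_mul 3).pow (n + 1)).div_const
        ((n + 1).factorial : ℝ)).const_mul 2
      refine h.congr_deriv ?_
      have : (n.factorial : ℝ) ≠ 0 := by positivity
      rw [Nat.factorial_succ]
      push_cast
      simp
      field_simp
    -- The equation holds only at positive times, so the comparison starts at `ε > 0`; continuity at
    -- `0` then removes the remainder `‖d ε‖`.
    have hε : ∀ ε ∈ Set.Ioo 0 t,
        ‖d t‖ ≤ 2 * ((3 * t) ^ (n + 1) / (n + 1).factorial) + ‖d ε‖ := by
      intro ε hε
      refine image_norm_le_of_norm_deriv_right_le_deriv_boundary (a := ε) (b := t) (f := d)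
        (B := fun s => 2 * ((3 * s) ^ (n + 1) / (n + 1).factorial) + ‖d ε‖)
        (fun s hs => (hderiv s (hε.1.trans_le hs.1)).continuousAt.continuousWithinAt)
        (fun s hs => (hderiv s (hε.1.trans_le hs.1)).hasDerivWithinAt) ?_
        (fun x => (hB x).add_const _) ?_ (Set.right_mem_Icc.2 hε.2.le)
      · have := hε.1
        have : 0 ≤ 2 * ((3 * ε) ^ (n + 1) / (n + 1).factorial) := by positivity
        linarith
      · intro s hs
        have hs0 : 0 < s := hε.1.trans_le hs.1
        have := hμ.isProbabilityMeasure s hs0.le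
        have := hν.isProbabilityMeasure s hs0.le
        have h1 := norm_gainHat_sub_le (P := P) hL hR (μ s) (ν s) (ih s hs0.le) ξ
        have h2 := ih s hs0.le ξ
        calc _ = ‖(gainHat P L R (charFun (μ s)) (charFun (μ s)) ξ
                - gainHat P L R (charFun (ν s)) (charFun (ν s)) ξ)
              - (charFun (μ s) ξ - charFun (ν s) ξ)‖ := by congr 1; ring
          _ ≤ _ := norm_sub_le _ _
          _ ≤ _ := by linarith
    have hlim : Tendsto (fun ε => 2 * ((3 * t) ^ (n + 1) / (n + 1).factorial) + ‖d ε‖) (𝓝[>] 0)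
        (𝓝 (2 * ((3 * t) ^ (n + 1) / (n + 1).factorial))) := by
      simpa using (tendsto_const_nhds.add hcont0.norm)
    refine ge_of_tendsto hlim ?_
    filter_upwards [Ioo_mem_nhdsGT ht] with ε h using hε ε h

/-- Weak solutions are determined by their initial datum. -/
theorem IsWeakSolution.unique (hL : Measurable L) (hR : Measurable R)
    {μ₀ : Measure ℝ} {μ ν : ℝ → Measure ℝ} (hμ : IsWeakSolution P L R μ₀ μ)
    (hν : IsWeakSolution P L R μ₀ ν) {t : ℝ} (ht : 0 ≤ t) : μ t = ν t := by
  have := hμ.isProbabilityMeasure t ht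
  have := hν.isProbabilityMeasure t ht
  refine Measure.ext_of_charFun (funext fun ξ => ?_)
  have hlim : Tendsto (fun n : ℕ => 2 * ((3 * t) ^ n / n.factorial)) atTop (𝓝 0) := by
    simpa using (FloorSemiring.tendsto_pow_div_factorial_atTop (3 * t)).const_mul 2
  have h : ‖charFun (μ t) ξ - charFun (ν t) ξ‖ ≤ 0 :=
    ge_of_tendsto hlim (.of_forall fun n => hμ.norm_charFun_sub_le hL hR hν n t ht ξ)
  exact sub_eq_zero.1 (norm_le_zero_iff.1 h)

end Uniqueness

/-! ### Wild expansion in a vector space -/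

section Wild

variable {E : Type*} [NormedAddCommGroup E] [NormedSpace ℝ E] [MeasurableSpace E] [BorelSpace E]
  [SecondCountableTopology E]

/-- The law of `L X + R Y` for independent `(L, R)`, `X ∼ μ` and `Y ∼ ν`. -/
def gain (P : Measure Ω) (L R : Ω → ℝ) (μ ν : Measure E) : Measure E :=
  (P.prod (μ.prod ν)).map fun z => L z.1 • z.2.1 + R z.1 • z.2.2

/-- The measures of the Wild expansion with initial datum `π`. -/
def wild (P : Measure Ω) (L R : Ω → ℝ) (π : Measure E) : ℕ → Measure E
  | 0 => π
  | n + 1 => ((n : ℝ≥0∞) + 1)⁻¹ •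
      ∑ j : Fin (n + 1), gain P L R (wild P L R π j) (wild P L R π (n - j))

/-- The sum of the Wild expansion at time `t ≥ 0`. -/
def wildFlow (P : Measure Ω) (L R : Ω → ℝ) (π : Measure E) (t : ℝ) : Measure E :=
  Measure.sum fun n : ℕ => ENNReal.ofReal (Real.exp (-t) * (1 - Real.exp (-t)) ^ n) • wild P L R π n

variable {P : Measure Ω} [IsProbabilityMeasure P] {L R : Ω → ℝ}

theorem measurable_collision (hL : Measurable L) (hR : Measurable R) :
    Measurable fun z : Ω × E × E => L z.1 • z.2.1 + R z.1 • z.2.2 := by fun_prop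

theorem isProbabilityMeasure_gain (hL : Measurable L) (hR : Measurable R) (μ ν : Measure E)
    [IsProbabilityMeasure μ] [IsProbabilityMeasure ν] : IsProbabilityMeasure (gain P L R μ ν) :=
  Measure.isProbabilityMeasure_map (measurable_collision hL hR).aemeasurable

theorem gain_smul (c d : ℝ≥0∞) (μ ν : Measure E) [SFinite μ] [SFinite ν] :
    gain P L R (c • μ) (d • ν) = (c * d) • gain P L R μ ν := by
  unfold gain
  rw [Measure.prod_smul_left, Measure.prod_smul_right, Measure.prod_smul_right,
    Measure.prod_smul_right, Measure.map_smul, Measure.map_smul, smul_smul]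

theorem gain_sum (hL : Measurable L) (hR : Measurable R) {ι ι' : Type*} [Countable ι] [Countable ι']
    (μ : ι → Measure E) (ν : ι' → Measure E) [∀ i, SFinite (μ i)] [∀ i, SFinite (ν i)] :
    gain P L R (Measure.sum μ) (Measure.sum ν)
      = Measure.sum fun i : ι × ι' => gain P L R (μ i.1) (ν i.2) := by
  unfold gain
  rw [Measure.prod_sum, Measure.prod_sum_right,
    Measure.map_sum (measurable_collision hL hR).aemeasurable]

theorem lintegral_gain (hL : Measurable L) (hR : Measurable R) (μ ν : Measure E) [SFinite μ]
    [SFinite ν] {f : E → ℝ≥0∞} (hf : Measurable f) :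
    ∫⁻ x, f x ∂gain P L R μ ν
      = ∫⁻ ω, ∫⁻ x, ∫⁻ y, f (L ω • x + R ω • y) ∂ν ∂μ ∂P := by
  have hc := measurable_collision (E := E) hL hR
  rw [gain, lintegral_map hf hc,
    lintegral_prod (fun z : Ω × E × E => f (L z.1 • z.2.1 + R z.1 • z.2.2))
      (hf.comp hc).aemeasurable]
  refine lintegral_congr fun ω => ?_
  rw [lintegral_prod]
  exact (hf.comp (hc.comp measurable_prodMk_left)).aemeasurable

theorem succ_smul_wild_succ (π : Measure E) (n : ℕ) :
    ((n : ℝ≥0∞) + 1) • wild P L R π (n + 1)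
      = ∑ i ∈ Finset.HasAntidiagonal.antidiagonal n,
        gain P L R (wild P L R π i.1) (wild P L R π i.2) := by
  rw [wild, smul_smul, ENNReal.mul_inv_cancel (by simp) (by simp), one_smul,
    Finset.Nat.sum_antidiagonal_eq_sum_range_succ
      (fun i j => gain P L R (wild P L R π i) (wild P L R π j)), Finset.sum_range]

theorem isProbabilityMeasure_wild (hL : Measurable L) (hR : Measurable R) (π : Measure E)
    [IsProbabilityMeasure π] (n : ℕ) : IsProbabilityMeasure (wild P L R π n) := by
  induction n using Nat.strong_induction_on with
  | _ n ih =>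
    rcases n with _ | n
    · rw [wild]; infer_instance
    · have h : ∀ j : Fin (n + 1),
          gain P L R (wild P L R π j) (wild P L R π (n - j)) Set.univ = 1 := by
        intro j
        have := ih j j.2
        have := ih (n - j) (by omega)
        have := isProbabilityMeasure_gain (P := P) hL hR (wild P L R π j) (wild P L R π (n - j))
        exact measure_univ
      refine ⟨?_⟩
      rw [wild, Measure.smul_apply, Measure.finsetSum_apply, Finset.sum_congr rfl fun j _ => h j]
      simp [ENNReal.inv_mul_cancel]

theorem one_sub_exp_neg_mem {t : ℝ} (ht : 0 ≤ t) :
    0 ≤ 1 - Real.exp (-t) ∧ |1 - Real.exp (-t)| < 1 := by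
  have h0 : 0 ≤ 1 - Real.exp (-t) := by
    rw [sub_nonneg]; exact Real.exp_le_one_iff.2 (by linarith)
  refine ⟨h0, ?_⟩
  rw [abs_of_nonneg h0]
  linarith [Real.exp_pos (-t)]

/-- A Cauchy product: with `z = 1 - exp (-t)`, every pair of indices of sum `n` carries the weight
`exp (-t) ^ 2 * z ^ n`, and by the Wild recursion the gains over these pairs add up to `n + 1`
copies of the next Wild measure. -/
theorem gain_wildFlow (hL : Measurable L) (hR : Measurable R) (π : Measure E)
    [IsProbabilityMeasure π] {t : ℝ} (ht : 0 ≤ t) :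
    gain P L R (wildFlow P L R π t) (wildFlow P L R π t) = Measure.sum fun n : ℕ =>
      ENNReal.ofReal (Real.exp (-t) ^ 2 * (((n : ℝ) + 1) * (1 - Real.exp (-t)) ^ n))
        • wild P L R π (n + 1) := by
  have hp := isProbabilityMeasure_wild (P := P) hL hR π
  have hz := (one_sub_exp_neg_mem ht).1
  unfold wildFlow
  rw [gain_sum hL hR]
  simp_rw [gain_smul]
  refine Measure.ext fun s hs => ?_
  rw [Measure.sum_apply _ hs, Measure.sum_apply _ hs,
    ← Finset.HasAntidiagonal.sigmaAntidiagonalEquivProd.tsum_eq, ENNReal.tsum_sigma']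
  refine tsum_congr fun n => ?_
  rw [tsum_fintype]
  have h : ((n : ℝ≥0∞) + 1) * wild P L R π (n + 1) s
      = ∑ i ∈ Finset.HasAntidiagonal.antidiagonal n,
        gain P L R (wild P L R π i.1) (wild P L R π i.2) s := by
    rw [← Measure.finsetSum_apply, ← succ_smul_wild_succ, Measure.smul_apply, smul_eq_mul]
  have hw : ENNReal.ofReal (Real.exp (-t) ^ 2 * (((n : ℝ) + 1) * (1 - Real.exp (-t)) ^ n))
      = ENNReal.ofReal (Real.exp (-t) ^ 2 * (1 - Real.exp (-t)) ^ n) * ((n : ℝ≥0∞) + 1) := by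
    have : ((n : ℝ≥0∞) + 1) = ENNReal.ofReal ((n : ℝ) + 1) := by
      rw [ENNReal.ofReal_add (by positivity) zero_le_one]; simp
    rw [this, ← ENNReal.ofReal_mul (by positivity)]
    ring_nf
  rw [Measure.smul_apply, smul_eq_mul, hw, mul_assoc, h, Finset.mul_sum,
    ← Finset.sum_coe_sort (Finset.HasAntidiagonal.antidiagonal n)]
  refine Finset.sum_congr rfl fun i _ => ?_
  have hi : i.1.1 + i.1.2 = n := Finset.HasAntidiagonal.mem_antidiagonal.1 i.2
  simp only [Finset.HasAntidiagonal.sigmaAntidiagonalEquivProd_apply, Measure.smul_apply,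
    smul_eq_mul]
  rw [← ENNReal.ofReal_mul (by positivity)]
  congr 2
  have hpow : (1 - Real.exp (-t)) ^ n
      = (1 - Real.exp (-t)) ^ i.1.1 * (1 - Real.exp (-t)) ^ i.1.2 := by rw [← pow_add, hi]
  rw [hpow]
  ring

theorem isProbabilityMeasure_wildFlow (hL : Measurable L) (hR : Measurable R) (π : Measure E)
    [IsProbabilityMeasure π] {t : ℝ} (ht : 0 ≤ t) :
    IsProbabilityMeasure (wildFlow P L R π t) := by
  have hp := isProbabilityMeasure_wild (P := P) hL hR π
  obtain ⟨hz, hz1⟩ := one_sub_exp_neg_mem ht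
  rw [abs_of_nonneg hz] at hz1
  refine ⟨?_⟩
  rw [wildFlow, Measure.sum_apply _ MeasurableSet.univ]
  simp only [Measure.smul_apply, measure_univ, smul_eq_mul, mul_one]
  rw [← ENNReal.ofReal_tsum_of_nonneg (fun n => by positivity)
    ((summable_geometric_of_lt_one hz hz1).mul_left _), tsum_mul_left,
    tsum_geometric_of_lt_one hz hz1, sub_sub_cancel, mul_inv_cancel₀ (Real.exp_pos _).ne']
  simp

theorem wildFlow_zero (π : Measure E) : wildFlow P L R π 0 = π := by
  refine Measure.ext fun s hs => ?_
  rw [wildFlow, Measure.sum_apply _ hs, tsum_eq_single 0]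
  · simp [wild]
  · intro n hn
    simp [hn]

/-- Bernoulli's inequality `1 + k / m ≤ (1 + 1 / m) ^ k`, cleared of denominators. -/
theorem add_mul_pow_le (m k : ℕ) : (m + k) * m ^ k ≤ m * (m + 1) ^ k := by
  induction k with
  | zero => simp
  | succ k ih =>
    calc (m + (k + 1)) * m ^ (k + 1) = (m + k + 1) * m * m ^ k := by ring
      _ ≤ (m + k) * (m + 1) * m ^ k := by
          exact Nat.mul_le_mul_right _ (by nlinarith [Nat.zero_le (m * k)])
      _ = (m + k) * m ^ k * (m + 1) := by ring
      _ ≤ m * (m + 1) ^ k * (m + 1) := by gcongr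
      _ = _ := by ring

/-- The hypothesis turns the Wild recursion into `(n + 1) a (n + 1) ≤ 2 c (a 0 + ⋯ + a n)`. Each
step then multiplies the partial sums by at most `1 + 2 c / (n + 1)`, hence polynomial growth of
degree `2 c`. This makes the Wild series of unbounded functions converge and be differentiable in
time. -/
theorem lintegral_wild_le (hL : Measurable L) (hR : Measurable R) (π : Measure E)
    [IsProbabilityMeasure π] {f : E → ℝ≥0∞} {c : ℕ}
    (hc : ∀ μ ν : Measure E, IsProbabilityMeasure μ → IsProbabilityMeasure ν →
      ∫⁻ x, f x ∂gain P L R μ ν ≤ c * (∫⁻ x, f x ∂μ + ∫⁻ x, f x ∂ν)) (n : ℕ) :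
    ∫⁻ x, f x ∂wild P L R π n ≤ (∫⁻ x, f x ∂π) * ((n : ℝ≥0∞) + 1) ^ (2 * c) := by
  have hp := isProbabilityMeasure_wild (P := P) hL hR π
  set a : ℕ → ℝ≥0∞ := fun n => ∫⁻ x, f x ∂wild P L R π n with ha
  have hrec : ∀ n : ℕ, ((n : ℝ≥0∞) + 1) * a (n + 1)
      ≤ (2 * c : ℕ) * ∑ j ∈ Finset.range (n + 1), a j := by
    intro n
    calc ((n : ℝ≥0∞) + 1) * a (n + 1)
        = ∑ i ∈ Finset.HasAntidiagonal.antidiagonal n,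
          ∫⁻ x, f x ∂gain P L R (wild P L R π i.1) (wild P L R π i.2) := by
          rw [← lintegral_finsetSum_measure, ← succ_smul_wild_succ, lintegral_smul_measure,
            smul_eq_mul]
      _ ≤ ∑ i ∈ Finset.HasAntidiagonal.antidiagonal n, c * (a i.1 + a i.2) :=
          Finset.sum_le_sum fun i _ => hc _ _ (hp _) (hp _)
      _ = _ := by
          rw [← Finset.mul_sum, Finset.sum_add_distrib,
            Finset.Nat.sum_antidiagonal_eq_sum_range_succ (fun i _ => a i),
            Finset.Nat.sum_antidiagonal_eq_sum_range_succ (fun _ j => a j),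
            ← Finset.sum_range_reflect a (n + 1)]
          have : ∀ j ∈ Finset.range (n + 1), a (n + 1 - 1 - j) = a (n - j) := fun j _ => by
            simp
          rw [Finset.sum_congr rfl this, Nat.succ_eq_add_one]
          push_cast
          ring
  have hs : ∀ n : ℕ, ∑ j ∈ Finset.range (n + 1), a j ≤ a 0 * ((n : ℝ≥0∞) + 1) ^ (2 * c) := by
    intro n
    induction n with
    | zero => simp
    | succ n ih =>
      have hn : ((n : ℝ≥0∞) + 1) ≠ 0 := by simp
      have hn' : ((n : ℝ≥0∞) + 1) ≠ ∞ := by simp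
      rw [← ENNReal.mul_le_mul_iff_right hn hn', Finset.sum_range_succ, mul_add]
      have hnat : (((n : ℝ≥0∞) + 1) + (2 * c : ℕ)) * ((n : ℝ≥0∞) + 1) ^ (2 * c)
          ≤ ((n : ℝ≥0∞) + 1) * (((n + 1 : ℕ) : ℝ≥0∞) + 1) ^ (2 * c) := by
        exact_mod_cast add_mul_pow_le (n + 1) (2 * c)
      calc _ ≤ ((n : ℝ≥0∞) + 1) * ∑ j ∈ Finset.range (n + 1), a j
            + (2 * c : ℕ) * ∑ j ∈ Finset.range (n + 1), a j := add_le_add le_rfl (hrec n)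
        _ = (((n : ℝ≥0∞) + 1) + (2 * c : ℕ)) * ∑ j ∈ Finset.range (n + 1), a j := by ring
        _ ≤ (((n : ℝ≥0∞) + 1) + (2 * c : ℕ)) * (a 0 * ((n : ℝ≥0∞) + 1) ^ (2 * c)) := by gcongr
        _ = a 0 * ((((n : ℝ≥0∞) + 1) + (2 * c : ℕ)) * ((n : ℝ≥0∞) + 1) ^ (2 * c)) := by ring
        _ ≤ a 0 * (((n : ℝ≥0∞) + 1) * (((n + 1 : ℕ) : ℝ≥0∞) + 1) ^ (2 * c)) := by gcongr
        _ = _ := by ring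
  have h0 : a 0 = ∫⁻ x, f x ∂π := by rw [ha]; simp only [wild]
  rw [← h0]
  exact (Finset.single_le_sum (fun _ _ => zero_le) (Finset.self_mem_range_succ n)).trans (hs n)

end Wild

/-! ### Integrals along the Wild expansion -/

section WildIntegral

variable {E : Type*} [NormedAddCommGroup E] [NormedSpace ℝ E] [MeasurableSpace E] [BorelSpace E]
  [SecondCountableTopology E] {F : Type*} [NormedAddCommGroup F] [NormedSpace ℝ F]
  [CompleteSpace F] [MeasurableSpace F] [BorelSpace F] [SecondCountableTopology F]
  {P : Measure Ω} [IsProbabilityMeasure P] {L R : Ω → ℝ}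

/-- The integral of the norm of `g` against `gain P L R μ ν` is controlled by its integrals
against `μ` and `ν`. -/
def GainBounded (P : Measure Ω) (L R : Ω → ℝ) (c : ℕ) (g : E → F) : Prop :=
  ∀ μ ν : Measure E, IsProbabilityMeasure μ → IsProbabilityMeasure ν →
    ∫⁻ x, ‖g x‖ₑ ∂gain P L R μ ν ≤ c * (∫⁻ x, ‖g x‖ₑ ∂μ + ∫⁻ x, ‖g x‖ₑ ∂ν)

theorem integrable_wild (hL : Measurable L) (hR : Measurable R) {π : Measure E}
    [IsProbabilityMeasure π] {g : E → F} (hg : Measurable g) {c : ℕ} (hc : GainBounded P L R c g)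
    (hπ : ∫⁻ x, ‖g x‖ₑ ∂π < ∞) (n : ℕ) : Integrable g (wild P L R π n) := by
  refine ⟨hg.aestronglyMeasurable, ?_⟩
  exact (lintegral_wild_le hL hR π hc n).trans_lt
    (ENNReal.mul_lt_top hπ (ENNReal.pow_lt_top (by simp [ENNReal.add_lt_top])))

theorem integral_norm_wild_le (hL : Measurable L) (hR : Measurable R) {π : Measure E}
    [IsProbabilityMeasure π] {g : E → F} (hg : Measurable g) {c : ℕ} (hc : GainBounded P L R c g)
    (hπ : ∫⁻ x, ‖g x‖ₑ ∂π < ∞) (n : ℕ) :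
    ∫ x, ‖g x‖ ∂wild P L R π n ≤ (∫⁻ x, ‖g x‖ₑ ∂π).toReal * ((n : ℝ) + 1) ^ (2 * c) := by
  rw [integral_norm_eq_lintegral_enorm hg.aestronglyMeasurable]
  have h := ENNReal.toReal_mono (ENNReal.mul_lt_top hπ
    (ENNReal.pow_lt_top (n := 2 * c) (by simp [ENNReal.add_lt_top]))).ne
    (lintegral_wild_le hL hR π hc n)
  refine h.trans_eq ?_
  rw [ENNReal.toReal_mul, ENNReal.toReal_pow]
  norm_cast

theorem norm_integral_wild_le (hL : Measurable L) (hR : Measurable R) {π : Measure E}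
    [IsProbabilityMeasure π] {g : E → F} (hg : Measurable g) {c : ℕ} (hc : GainBounded P L R c g)
    (hπ : ∫⁻ x, ‖g x‖ₑ ∂π < ∞) (n : ℕ) :
    ‖∫ x, g x ∂wild P L R π n‖ ≤ (∫⁻ x, ‖g x‖ₑ ∂π).toReal * ((n : ℝ) + 1) ^ (2 * c) :=
  (norm_integral_le_integral_norm _).trans (integral_norm_wild_le hL hR hg hc hπ n)

theorem integrable_wildFlow (hL : Measurable L) (hR : Measurable R) {π : Measure E}
    [IsProbabilityMeasure π] {g : E → F} (hg : Measurable g) {c : ℕ} (hc : GainBounded P L R c g)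
    (hπ : ∫⁻ x, ‖g x‖ₑ ∂π < ∞) {t : ℝ} (ht : 0 ≤ t) : Integrable g (wildFlow P L R π t) := by
  obtain ⟨hz, hz1⟩ := one_sub_exp_neg_mem ht
  refine integrable_sum_measure
    (fun n => (integrable_wild hL hR hg hc hπ n).smul_measure ENNReal.ofReal_ne_top) ?_
  have hn : ∀ n, ‖∫ x, ‖g x‖ ∂wild P L R π n‖
      ≤ (∫⁻ x, ‖g x‖ₑ ∂π).toReal * ((n : ℝ) + 1) ^ (2 * c) := fun n => by
    rw [Real.norm_of_nonneg (integral_nonneg fun _ => norm_nonneg _)]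
    exact integral_norm_wild_le hL hR hg hc hπ n
  refine ((summable_smul_of_polynomial_growth hn hz1).mul_left (Real.exp (-t))).congr fun n => ?_
  rw [integral_smul_measure, ENNReal.toReal_ofReal (by positivity), smul_eq_mul, smul_eq_mul,
    mul_assoc]

theorem integral_wildFlow (hL : Measurable L) (hR : Measurable R) {π : Measure E}
    [IsProbabilityMeasure π] {g : E → F} (hg : Measurable g) {c : ℕ} (hc : GainBounded P L R c g)
    (hπ : ∫⁻ x, ‖g x‖ₑ ∂π < ∞) {t : ℝ} (ht : 0 ≤ t) :
    ∫ x, g x ∂wildFlow P L R π t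
      = Real.exp (-t) • ∑' n : ℕ, (1 - Real.exp (-t)) ^ n • ∫ x, g x ∂wild P L R π n := by
  obtain ⟨hz, hz1⟩ := one_sub_exp_neg_mem ht
  have hi := integrable_wildFlow hL hR hg hc hπ ht
  unfold wildFlow at hi ⊢
  rw [integral_sum_measure hi, ← Summable.tsum_const_smul _
    (summable_smul_of_polynomial_growth (norm_integral_wild_le hL hR hg hc hπ) hz1)]
  refine tsum_congr fun n => ?_
  rw [integral_smul_measure, ENNReal.toReal_ofReal (by positivity), mul_smul]

theorem integrable_gain_wildFlow (hL : Measurable L) (hR : Measurable R) {π : Measure E}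
    [IsProbabilityMeasure π] {g : E → F} (hg : Measurable g) {c : ℕ} (hc : GainBounded P L R c g)
    (hπ : ∫⁻ x, ‖g x‖ₑ ∂π < ∞) {t : ℝ} (ht : 0 ≤ t) :
    Integrable g (gain P L R (wildFlow P L R π t) (wildFlow P L R π t)) := by
  have hp := isProbabilityMeasure_wildFlow (P := P) hL hR π ht
  refine ⟨hg.aestronglyMeasurable, (hc _ _ hp hp).trans_lt ?_⟩
  have h := (integrable_wildFlow hL hR hg hc hπ ht).2
  exact ENNReal.mul_lt_top (by simp) (ENNReal.add_lt_top.2 ⟨h, h⟩)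

theorem integral_gain_wildFlow (hL : Measurable L) (hR : Measurable R) {π : Measure E}
    [IsProbabilityMeasure π] {g : E → F} (hg : Measurable g) {c : ℕ} (hc : GainBounded P L R c g)
    (hπ : ∫⁻ x, ‖g x‖ₑ ∂π < ∞) {t : ℝ} (ht : 0 ≤ t) :
    ∫ x, g x ∂gain P L R (wildFlow P L R π t) (wildFlow P L R π t)
      = Real.exp (-t) ^ 2 • ∑' n : ℕ, (((n : ℝ) + 1) * (1 - Real.exp (-t)) ^ n) •
        ∫ x, g x ∂wild P L R π (n + 1) := by
  obtain ⟨hz, hz1⟩ := one_sub_exp_neg_mem ht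
  have hi := integrable_gain_wildFlow hL hR hg hc hπ ht
  rw [gain_wildFlow hL hR π ht] at hi ⊢
  rw [integral_sum_measure hi, ← tsum_const_smul'']
  refine tsum_congr fun n => ?_
  rw [integral_smul_measure, ENNReal.toReal_ofReal (by positivity), mul_smul]

/-- The Wild expansion solves the evolution equation, tested against functions whose integrals
are controlled along it. -/
theorem hasDerivWithinAt_integral_wildFlow (hL : Measurable L) (hR : Measurable R) {π : Measure E}
    [IsProbabilityMeasure π] {g : E → F} (hg : Measurable g) {c : ℕ} (hc : GainBounded P L R c g)
    (hπ : ∫⁻ x, ‖g x‖ₑ ∂π < ∞) {t : ℝ} (ht : 0 ≤ t) :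
    HasDerivWithinAt (fun s => ∫ x, g x ∂wildFlow P L R π s)
      (∫ x, g x ∂gain P L R (wildFlow P L R π t) (wildFlow P L R π t)
        - ∫ x, g x ∂wildFlow P L R π t) (Set.Ici 0) t := by
  obtain ⟨hz, hz1⟩ := one_sub_exp_neg_mem ht
  -- The integral at time `t` is `exp (-t) • G z` with `z = 1 - exp (-t)` and `dz/dt = exp (-t)`.
  -- Its derivative is `exp (-t) ^ 2 • G' z - exp (-t) • G z`, that is, gain minus loss.
  set G : ℝ → F := fun z => ∑' n : ℕ, z ^ n • ∫ x, g x ∂wild P L R π n with hG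
  have hexp : HasDerivAt (fun s : ℝ => Real.exp (-s)) (-Real.exp (-t)) t := by
    simpa using (hasDerivAt_neg t).exp
  have hz' : HasDerivAt (fun s : ℝ => 1 - Real.exp (-s)) (Real.exp (-t)) t := by
    simpa using hexp.const_sub 1
  have hGd := hasDerivAt_tsum_pow_smul (norm_integral_wild_le hL hR hg hc hπ) hz1
  have h : HasDerivAt (fun s : ℝ => Real.exp (-s) • G (1 - Real.exp (-s)))
      (∫ x, g x ∂gain P L R (wildFlow P L R π t) (wildFlow P L R π t)
        - ∫ x, g x ∂wildFlow P L R π t) t := by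
    refine (hexp.smul (HasDerivAt.scomp t hGd hz')).congr_deriv ?_
    rw [integral_gain_wildFlow hL hR hg hc hπ ht, integral_wildFlow hL hR hg hc hπ ht, smul_smul,
      sq, neg_smul, ← sub_eq_add_neg]
    rfl
  exact h.hasDerivWithinAt.congr (fun s hs => integral_wildFlow hL hR hg hc hπ hs)
    (integral_wildFlow hL hR hg hc hπ ht)

end WildIntegral

/-! ### Marginals of the Wild expansion -/

section Marginals

variable {E : Type*} [NormedAddCommGroup E] [NormedSpace ℝ E] [MeasurableSpace E] [BorelSpace E]
  [SecondCountableTopology E] {P : Measure Ω} [IsProbabilityMeasure P] {L R : Ω → ℝ}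

theorem charFun_map_clm (ℓ : E →L[ℝ] ℝ) (μ : Measure E) (ξ : ℝ) :
    charFun (μ.map ℓ) ξ = ∫ x, Complex.exp (ξ * ℓ x * Complex.I) ∂μ := by
  rw [charFun_apply_real, integral_map ℓ.continuous.aemeasurable]
  exact (by fun_prop : Measurable fun x : ℝ => Complex.exp (ξ * x * Complex.I)).aestronglyMeasurable

theorem integral_gain (hL : Measurable L) (hR : Measurable R) (μ ν : Measure E)
    [IsProbabilityMeasure μ] [IsProbabilityMeasure ν] {F : Type*} [NormedAddCommGroup F]
    [NormedSpace ℝ F] {g : E → F}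
    (hg : Integrable g (gain P L R μ ν)) :
    ∫ x, g x ∂gain P L R μ ν = ∫ ω, ∫ z : E × E, g (L ω • z.1 + R ω • z.2) ∂μ.prod ν ∂P := by
  have hc := (measurable_collision (E := E) hL hR).aemeasurable (μ := P.prod (μ.prod ν))
  rw [gain] at hg ⊢
  rw [integral_map hc hg.1, integral_prod]
  exact (integrable_map_measure hg.1 hc).1 hg

/-- `L` and `R` act as scalars, so a linear functional commutes with collisions; independence of the
two colliding vectors then factorises the exponential. -/
theorem charFun_gain_map (hL : Measurable L) (hR : Measurable R) (ℓ : E →L[ℝ] ℝ) (μ ν : Measure E)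
    [IsProbabilityMeasure μ] [IsProbabilityMeasure ν] (ξ : ℝ) :
    charFun ((gain P L R μ ν).map ℓ) ξ
      = gainHat P L R (charFun (μ.map ℓ)) (charFun (ν.map ℓ)) ξ := by
  have := isProbabilityMeasure_gain (P := P) hL hR μ ν
  rw [charFun_map_clm, integral_gain hL hR]
  · refine integral_congr_ae (.of_forall fun ω => ?_)
    simp only
    rw [charFun_map_clm, charFun_map_clm, ← integral_prod_mul]
    refine integral_congr_ae (.of_forall fun z => ?_)
    simp only [map_add, map_smul, smul_eq_mul]
    rw [← Complex.exp_add]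
    push_cast
    ring_nf
  · refine Integrable.of_bound (C := 1) ?_ (.of_forall fun x => ?_)
    · exact (by fun_prop :
        Measurable fun x : E => Complex.exp (ξ * ℓ x * Complex.I)).aestronglyMeasurable
    · rw [← Complex.ofReal_mul, Complex.norm_exp_ofReal_mul_I]

/-- The one-dimensional marginals of the Wild expansion are weak solutions. -/
theorem isWeakSolution_map_wildFlow (hL : Measurable L) (hR : Measurable R) (ℓ : E →L[ℝ] ℝ)
    (π : Measure E) [IsProbabilityMeasure π] :
    IsWeakSolution P L R (π.map ℓ) (fun t => (wildFlow P L R π t).map ℓ) := by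
  have hderiv : ∀ ξ t : ℝ, 0 ≤ t →
      HasDerivWithinAt (fun s : ℝ => charFun ((wildFlow P L R π s).map ℓ) ξ)
        (gainHat P L R (charFun ((wildFlow P L R π t).map ℓ))
          (charFun ((wildFlow P L R π t).map ℓ)) ξ
          - charFun ((wildFlow P L R π t).map ℓ) ξ) (Set.Ici 0) t := by
    intro ξ t ht
    have hp := isProbabilityMeasure_wildFlow (P := P) hL hR π ht
    have hn : ∀ x : E, ‖Complex.exp (ξ * ℓ x * Complex.I)‖ₑ = 1 := fun x => by
      rw [← ofReal_norm, ← Complex.ofReal_mul, Complex.norm_exp_ofReal_mul_I, ENNReal.ofReal_one]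
    rw [← charFun_gain_map hL hR, charFun_map_clm, charFun_map_clm]
    simp_rw [charFun_map_clm]
    refine hasDerivWithinAt_integral_wildFlow (c := 1) hL hR (by fun_prop) ?_ ?_ ht
    · intro μ ν hμ hν
      have := isProbabilityMeasure_gain (P := P) hL hR μ ν
      simp [hn]
    · simp [hn]
  refine ⟨fun t ht => ?_, ?_, fun ξ => ?_, fun t ht ξ => ?_⟩
  · have := isProbabilityMeasure_wildFlow (P := P) hL hR π ht
    exact Measure.isProbabilityMeasure_map ℓ.continuous.aemeasurable
  · rw [wildFlow_zero]
  · exact (hderiv ξ 0 le_rfl).continuousWithinAt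
  · exact (hderiv ξ t ht.le).hasDerivAt (Ici_mem_nhds ht)

end Marginals

/-! ### An expansion of powers of sums and Gronwall estimates -/

section Gronwall

/-- The point is the coefficient `1` of `a ^ p` and `b ^ p`, without which the rate `S(p)` would be
lost. For `b ≤ a`, Bernoulli gives `(a + b) ^ p - a ^ p ≤ p b (a + b) ^ (p - 1)`, and `a + b ≤ 2 a`.
-/
theorem add_rpow_le_of_one_le {a b p : ℝ} (ha : 0 ≤ a) (hb : 0 ≤ b) (hp : 1 ≤ p) :
    (a + b) ^ p ≤ a ^ p + b ^ p + p * 2 ^ (p - 1) * (a ^ (p - 1) * b + a * b ^ (p - 1)) := by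
  wlog hab : b ≤ a generalizing a b
  · have h := this hb ha (le_of_not_ge hab)
    rw [add_comm a b]
    linarith
  rcases ha.eq_or_lt with rfl | ha
  · obtain rfl : b = 0 := le_antisymm hab hb
    have : (0 : ℝ) ^ p = 0 := Real.zero_rpow (by linarith)
    simp [this]
  have hs : 0 < a + b := by linarith
  have h1 : 1 + p * (-(b / (a + b))) ≤ (1 + -(b / (a + b))) ^ p := by
    refine one_add_mul_self_le_rpow_one_add ?_ hp
    rw [neg_le_neg_iff, div_le_one hs]
    linarith
  have h2 : 1 + -(b / (a + b)) = a / (a + b) := by field_simp; ring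
  rw [h2, Real.div_rpow ha.le hs.le, le_div_iff₀ (by positivity)] at h1
  have h3 : (a + b) ^ p = (a + b) ^ (p - 1) * (a + b) := by
    rw [← Real.rpow_add_one hs.ne', sub_add_cancel]
  have h4 : (a + b) ^ p ≤ a ^ p + p * b * (a + b) ^ (p - 1) := by
    have : (1 + p * (-(b / (a + b)))) * (a + b) ^ p
        = (a + b) ^ p - p * b * (a + b) ^ (p - 1) := by
      rw [h3]; field_simp; ring
    linarith
  have h5 : (a + b) ^ (p - 1) ≤ 2 ^ (p - 1) * a ^ (p - 1) := by
    rw [← Real.mul_rpow zero_le_two ha.le]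
    exact Real.rpow_le_rpow hs.le (by linarith) (by linarith)
  have h6 : p * b * (a + b) ^ (p - 1) ≤ p * b * (2 ^ (p - 1) * a ^ (p - 1)) := by gcongr
  have h7 : 0 ≤ p * 2 ^ (p - 1) * (a * b ^ (p - 1)) := by positivity
  have h8 : 0 ≤ b ^ p := by positivity
  linarith

theorem le_gronwallBound_of_hasDerivWithinAt {f f' : ℝ → ℝ} {K ε : ℝ}
    (hf : ∀ t, 0 ≤ t → HasDerivWithinAt f (f' t) (Set.Ici 0) t)
    (bound : ∀ t, 0 ≤ t → f' t ≤ K * f t + ε) {t : ℝ} (ht : 0 ≤ t) :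
    f t ≤ gronwallBound (f 0) K ε t := by
  have h := le_gronwallBound_of_liminf_deriv_right_le (f := f) (f' := f') (δ := f 0) (K := K)
    (ε := ε) (a := 0) (b := t)
    (fun s hs => ((hf s hs.1).continuousWithinAt).mono Set.Icc_subset_Ici_self)
    (fun s hs r hr => ?_) le_rfl (fun s hs => bound s hs.1) t (Set.right_mem_Icc.2 ht)
  · simpa using h
  · have := ((hf s hs.1).mono (Set.Ici_subset_Ici.2 hs.1)).liminf_right_slope_le hr
    simpa [slope_def_field, div_eq_inv_mul] using this

theorem gronwallBound_le_exp {δ K ε t : ℝ} (hδ : 0 ≤ δ) (hε : 0 ≤ ε) (hK : K ≠ 0) (ht : 0 ≤ t) :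
    gronwallBound δ K ε t ≤ (δ + ε / |K|) * Real.exp (max 0 K * t) := by
  rw [gronwallBound_of_K_ne_0 hK]
  rcases lt_or_gt_of_ne hK with h | h
  · rw [max_eq_left h.le, abs_of_neg h, zero_mul, Real.exp_zero]
    have h1 : Real.exp (K * t) ≤ 1 := Real.exp_le_one_iff.2 (by nlinarith)
    have h2 : 0 ≤ ε / -K := div_nonneg hε (by linarith)
    have h3 : ε / K = -(ε / -K) := by rw [div_neg, neg_neg]
    rw [h3]
    nlinarith [Real.exp_pos (K * t)]
  · rw [max_eq_right h.le, abs_of_pos h]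
    have h2 : 0 ≤ ε / K := by positivity
    linarith

/-- A Gronwall estimate for the nonlinear inequality `m' ≤ a m + K m₁ m ^ (1 - 1/p)` satisfied by
a moment of order `p`, when `m₁` decays with rate `s`. -/
theorem exists_rpow_inv_le {m m' m₁ m₁' : ℝ → ℝ} {p a s K : ℝ} (hp : 1 < p) (hK : 0 ≤ K)
    (hm : ∀ t, 0 ≤ t → HasDerivWithinAt m (m' t) (Set.Ici 0) t)
    (hm₁ : ∀ t, 0 ≤ t → HasDerivWithinAt m₁ (m₁' t) (Set.Ici 0) t)
    (h0 : ∀ t, 0 ≤ t → 0 ≤ m t) (h₁0 : ∀ t, 0 ≤ t → 0 ≤ m₁ t)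
    (hb₁ : ∀ t, 0 ≤ t → m₁' t ≤ s * m₁ t)
    (hb : ∀ t, 0 ≤ t → m' t ≤ a * m t + K * (m₁ t * m t ^ (1 - 1 / p))) :
    ∃ C : ℝ, 0 < C ∧
      (a / p ≠ s → ∀ t, 0 ≤ t → m t ^ (1 / p) ≤ C * Real.exp (max s (a / p) * t)) ∧
      (a / p = s → ∀ t, 0 ≤ t → m t ^ (1 / p) ≤ C * max 1 t * Real.exp (s * t)) := by
  have hp0 : 0 < p := by linarith
  set M := m₁ 0 with hM
  have hM0 : 0 ≤ M := h₁0 0 le_rfl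
  have hdecay : ∀ t, 0 ≤ t → m₁ t ≤ M * Real.exp (s * t) := fun t ht => by
    have h := le_gronwallBound_of_hasDerivWithinAt (K := s) (ε := 0) hm₁
      (fun t ht => by simpa using hb₁ t ht) ht
    rwa [gronwallBound_ε0] at h
  -- Multiplying `m` by `exp (-p s t)` makes the forcing coefficient the constant `K M`; `b` is the
  -- gap between the two rates.
  set b := a / p - s with hbdef
  set u : ℝ → ℝ := fun t => m t * Real.exp (-(p * s) * t) with hu
  set u' : ℝ → ℝ := fun t => m' t * Real.exp (-(p * s) * t)
    + m t * (Real.exp (-(p * s) * t) * (-(p * s))) with hu'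
  have hu0 : ∀ t, 0 ≤ t → 0 ≤ u t := fun t ht => mul_nonneg (h0 t ht) (Real.exp_pos _).le
  have hud : ∀ t, 0 ≤ t → HasDerivWithinAt u (u' t) (Set.Ici 0) t := fun t ht => by
    have he : HasDerivAt (fun t : ℝ => Real.exp (-(p * s) * t))
        (Real.exp (-(p * s) * t) * (-(p * s))) t := by
      simpa using ((hasDerivAt_id t).const_mul (-(p * s))).exp
    exact (hm t ht).mul he.hasDerivWithinAt
  have hub : ∀ t, 0 ≤ t → u' t ≤ p * b * u t + K * M * u t ^ (1 - 1 / p) := fun t ht => by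
    set e := Real.exp (-(p * s) * t) with he
    have he0 : 0 < e := Real.exp_pos _
    -- The factor splits into `exp (-s t)`, which compensates `m₁`, and `e ^ (1 - 1/p)`, which turns
    -- `m ^ (1 - 1/p)` into `u ^ (1 - 1/p)`.
    have hsplit : e = Real.exp (-(s * t)) * e ^ (1 - 1 / p) := by
      rw [he, ← Real.exp_mul, ← Real.exp_add]
      congr 1
      field_simp
      ring
    have h1 : K * (m₁ t * m t ^ (1 - 1 / p)) * e ≤ K * M * u t ^ (1 - 1 / p) := by
      have hx : m₁ t * Real.exp (-(s * t)) ≤ M := by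
        have := mul_le_mul_of_nonneg_right (hdecay t ht) (Real.exp_pos (-(s * t))).le
        rwa [mul_assoc, ← Real.exp_add, add_neg_cancel, Real.exp_zero, mul_one] at this
      have hy : 0 ≤ m t ^ (1 - 1 / p) * e ^ (1 - 1 / p) :=
        mul_nonneg (Real.rpow_nonneg (h0 t ht) _) (Real.rpow_nonneg he0.le _)
      calc K * (m₁ t * m t ^ (1 - 1 / p)) * e
          = K * ((m₁ t * Real.exp (-(s * t))) * (m t ^ (1 - 1 / p) * e ^ (1 - 1 / p))) := by
            nth_rw 1 [hsplit]; ring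
        _ ≤ K * (M * (m t ^ (1 - 1 / p) * e ^ (1 - 1 / p))) := by gcongr
        _ = K * M * u t ^ (1 - 1 / p) := by
            rw [hu, Real.mul_rpow (h0 t ht) he0.le]; ring
    have h2 := mul_le_mul_of_nonneg_right (hb t ht) he0.le
    have h3 : p * b = a - p * s := by rw [hbdef]; field_simp
    rw [h3]
    simp only [hu', hu]
    rw [← he]
    linarith
  -- The root makes the inequality linear, `w' ≤ b w + c`; the shift by `1` avoids the singularity
  -- of the root at `0`.
  set w : ℝ → ℝ := fun t => (1 + u t) ^ (1 / p) with hw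
  set c := K * M / p + |b| with hc
  have hc0 : 0 ≤ c := by positivity
  have hwd : ∀ t, 0 ≤ t → HasDerivWithinAt w (u' t * (1 / p) * (1 + u t) ^ (1 / p - 1))
      (Set.Ici 0) t := fun t ht =>
    ((hud t ht).const_add 1).rpow_const (Or.inl (by linarith [hu0 t ht]))
  have hwb : ∀ t, 0 ≤ t → u' t * (1 / p) * (1 + u t) ^ (1 / p - 1) ≤ b * w t + c := fun t ht => by
    have hv0 := hu0 t ht
    set v := u t with hv
    set q := (1 + v) ^ (1 / p - 1) with hq
    have hq0 : 0 < q := Real.rpow_pos_of_pos (by linarith) _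
    have hq1 : q ≤ 1 := Real.rpow_le_one_of_one_le_of_nonpos (by linarith)
      (by rw [sub_nonpos, div_le_one hp0]; exact hp.le)
    have hwq : w t = q * (1 + v) := by
      rw [hq, ← Real.rpow_add_one (by linarith), sub_add_cancel]
    have hvq : v ^ (1 - 1 / p) * q ≤ 1 := by
      have h1 : v ^ (1 - 1 / p) ≤ (1 + v) ^ (1 - 1 / p) :=
        Real.rpow_le_rpow hv0 (by linarith) (by rw [sub_nonneg, div_le_one hp0]; exact hp.le)
      calc v ^ (1 - 1 / p) * q ≤ (1 + v) ^ (1 - 1 / p) * q := by gcongr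
        _ = 1 := by
            rw [hq, ← Real.rpow_add (by linarith)]; simp
    calc u' t * (1 / p) * q ≤ (p * b * v + K * M * v ^ (1 - 1 / p)) * (1 / p) * q := by
          gcongr
          exact hub t ht
      _ = b * (q * v) + K * M / p * (v ^ (1 - 1 / p) * q) := by field_simp
      _ ≤ b * (q * v) + K * M / p * 1 := by gcongr
      _ ≤ b * w t + c := by
          rw [hwq, hc]
          -- Since `q * v = w t - q`, the shift leaves the error `-b * q`, which the summand `|b|`
          -- of `c` absorbs.
          have : -|b| ≤ b * q := by
            have h1 : |b * q| ≤ |b| := by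
              rw [abs_mul, abs_of_pos hq0]
              exact mul_le_of_le_one_right (abs_nonneg _) hq1
            linarith [neg_abs_le (b * q)]
          linarith
  have hw0 : 1 ≤ w 0 := Real.one_le_rpow (by linarith [hu0 0 le_rfl]) (by positivity)
  have hmw : ∀ t, 0 ≤ t → m t ^ (1 / p) ≤ gronwallBound (w 0) b c t * Real.exp (s * t) :=
    fun t ht => by
    have h1 : m t = u t * Real.exp (s * t) ^ p := by
      rw [hu, ← Real.exp_mul, mul_assoc, ← Real.exp_add]
      ring_nf
      simp
    have h2 : m t ^ (1 / p) = u t ^ (1 / p) * Real.exp (s * t) := by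
      rw [h1, Real.mul_rpow (hu0 t ht) (by positivity), one_div,
        Real.rpow_rpow_inv (Real.exp_pos _).le hp0.ne']
    rw [h2]
    gcongr
    refine le_trans ?_ (le_gronwallBound_of_hasDerivWithinAt hwd hwb ht)
    exact Real.rpow_le_rpow (hu0 t ht) (by linarith) (by positivity)
  -- One constant serves both cases: for `b = 0` the quotient `c / |b|` is `0` by convention, and
  -- the linear growth `w 0 + c t` produces the factor `max 1 t`.
  refine ⟨w 0 + c + c / |b|, by positivity, fun hne t ht => ?_, fun heq t ht => ?_⟩
  · have hb0 : b ≠ 0 := sub_ne_zero.2 hne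
    refine (hmw t ht).trans ?_
    calc gronwallBound (w 0) b c t * Real.exp (s * t)
        ≤ (w 0 + c / |b|) * Real.exp (max 0 b * t) * Real.exp (s * t) := by
          gcongr
          exact gronwallBound_le_exp (by linarith) hc0 hb0 ht
      _ = (w 0 + c / |b|) * Real.exp (max s (a / p) * t) := by
          rw [mul_assoc, ← Real.exp_add, ← add_mul, max_add, zero_add, hbdef, sub_add_cancel]
      _ ≤ _ := by
          gcongr
          linarith
  · have hb0 : b = 0 := sub_eq_zero.2 heq
    refine (hmw t ht).trans ?_
    refine mul_le_mul_of_nonneg_right ?_ (Real.exp_pos _).le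
    rw [hb0, gronwallBound_K0, abs_zero, div_zero, add_zero, add_mul]
    exact add_le_add (le_mul_of_one_le_right (by linarith) (le_max_left _ _))
      (mul_le_mul_of_nonneg_left (le_max_right _ _) hc0)

end Gronwall

/-! ### Evolution of absolute moments -/

section Moments

variable {E : Type*} [NormedAddCommGroup E] [NormedSpace ℝ E] [MeasurableSpace E] [BorelSpace E]
  [SecondCountableTopology E] {P : Measure Ω} [IsProbabilityMeasure P] {L R : Ω → ℝ}

/-- Convexity gives the crude constant `2 ^ (q - 1) * E[|L| ^ q + |R| ^ q]`, rounded up to an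
integer. It serves only integrability and differentiability; the rates come from sharper bounds. -/
theorem exists_gainBounded_rpow (hL : Measurable L) (hR : Measurable R) (ℓ : E →L[ℝ] ℝ) {q : ℝ}
    (hq : 1 ≤ q) (hLq : Integrable (fun ω => |L ω| ^ q) P)
    (hRq : Integrable (fun ω => |R ω| ^ q) P) :
    ∃ c : ℕ, GainBounded P L R c fun x : E => |ℓ x| ^ q := by
  have hq0 : 0 ≤ q := by linarith
  have hn : ∀ x : ℝ, ‖|x| ^ q‖ₑ = ‖x‖ₑ ^ q := fun x => by
    rw [Real.enorm_rpow_of_nonneg (abs_nonneg x) hq0, ← ofReal_norm |x|,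
      norm_abs_eq_norm, ofReal_norm]
  have hLf := hLq.2
  have hRf := hRq.2
  unfold HasFiniteIntegral at hLf hRf
  simp_rw [hn] at hLf hRf
  set A := ∫⁻ ω, ‖L ω‖ₑ ^ q ∂P with hA
  set B := ∫⁻ ω, ‖R ω‖ₑ ^ q ∂P with hB
  obtain ⟨c, hc⟩ := ENNReal.exists_nat_gt (r := 2 ^ (q - 1) * (A + B))
    (ENNReal.mul_ne_top (by finiteness) (ENNReal.add_lt_top.2 ⟨hLf, hRf⟩).ne)
  refine ⟨c, fun μ ν _ _ => ?_⟩
  simp_rw [hn]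
  have hmx : Measurable fun x : E => ‖ℓ x‖ₑ ^ q := by fun_prop
  rw [lintegral_gain hL hR μ ν hmx]
  set X := ∫⁻ x, ‖ℓ x‖ₑ ^ q ∂μ with hX
  set Y := ∫⁻ x, ‖ℓ x‖ₑ ^ q ∂ν with hY
  calc ∫⁻ ω, ∫⁻ x, ∫⁻ y, ‖ℓ (L ω • x + R ω • y)‖ₑ ^ q ∂ν ∂μ ∂P
      ≤ ∫⁻ ω, ∫⁻ x, ∫⁻ y, 2 ^ (q - 1) *
          (‖L ω‖ₑ ^ q * ‖ℓ x‖ₑ ^ q + ‖R ω‖ₑ ^ q * ‖ℓ y‖ₑ ^ q) ∂ν ∂μ ∂P := by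
        refine lintegral_mono fun ω => lintegral_mono fun x => lintegral_mono fun y => ?_
        rw [map_add, map_smul, map_smul]
        refine (ENNReal.rpow_le_rpow (enorm_add_le _ _) hq0).trans ?_
        refine (ENNReal.rpow_add_le_mul_rpow_add_rpow _ _ hq).trans_eq ?_
        rw [enorm_smul, enorm_smul, ENNReal.mul_rpow_of_nonneg _ _ hq0,
          ENNReal.mul_rpow_of_nonneg _ _ hq0]
    _ = ∫⁻ ω, 2 ^ (q - 1) * (‖L ω‖ₑ ^ q * X + ‖R ω‖ₑ ^ q * Y) ∂P := by
        refine lintegral_congr fun ω => ?_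
        simp_rw [lintegral_const_mul _ (hmx.const_mul (‖R ω‖ₑ ^ q) |>.const_add _)]
        rw [lintegral_const_mul _ (by fun_prop)]
        congr 1
        simp_rw [lintegral_add_left measurable_const, lintegral_const_mul _ hmx]
        simp only [lintegral_const, measure_univ, mul_one]
        rw [lintegral_add_right _ measurable_const, lintegral_const_mul _ hmx]
        simp [hX, hY]
    _ = 2 ^ (q - 1) * (A * X + B * Y) := by
        rw [lintegral_const_mul _ (by fun_prop), lintegral_add_left (by fun_prop),
          lintegral_mul_const _ (by fun_prop), lintegral_mul_const _ (by fun_prop)]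
    _ ≤ 2 ^ (q - 1) * ((A + B) * X + (A + B) * Y) := by
        gcongr
        · exact le_self_add
        · exact le_add_self
    _ = 2 ^ (q - 1) * (A + B) * (X + Y) := by ring
    _ ≤ c * (X + Y) := by gcongr

theorem rpow_le_one_add_rpow {x s p : ℝ} (hx : 0 ≤ x) (hs : 0 ≤ s) (hsp : s ≤ p) :
    x ^ s ≤ 1 + x ^ p := by
  rcases le_total x 1 with h | h
  · linarith [Real.rpow_le_one hx h hs, Real.rpow_nonneg hx p]
  · linarith [Real.rpow_le_rpow_of_exponent_le h hsp]

theorem integrable_rpow_of_le {X : Type*} [MeasurableSpace X] {μ : Measure X}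
    [IsProbabilityMeasure μ] {f : X → ℝ} (hf : Measurable f) {s p : ℝ} (hs : 0 ≤ s) (hsp : s ≤ p)
    (h : Integrable (fun x => |f x| ^ p) μ) : Integrable (fun x => |f x| ^ s) μ := by
  refine ((integrable_const (1 : ℝ)).add h).mono' (by fun_prop) (.of_forall fun x => ?_)
  rw [Real.norm_of_nonneg (by positivity)]
  exact rpow_le_one_add_rpow (abs_nonneg _) hs hsp

/-- Jensen's inequality for the convex power `p / (p - 1)` applied to `|f| ^ (p - 1)`. -/
theorem integral_rpow_sub_one_le {X : Type*} [MeasurableSpace X] {μ : Measure X}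
    [IsProbabilityMeasure μ] {f : X → ℝ} (hf : Measurable f) {p : ℝ} (hp : 1 < p)
    (h : Integrable (fun x => |f x| ^ p) μ) :
    ∫ x, |f x| ^ (p - 1) ∂μ ≤ (∫ x, |f x| ^ p ∂μ) ^ (1 - 1 / p) := by
  have hp1 : 0 < p - 1 := by linarith
  have hr : 1 ≤ p / (p - 1) := by rw [le_div_iff₀ hp1]; linarith
  have hpow : ∀ x, (|f x| ^ (p - 1)) ^ (p / (p - 1)) = |f x| ^ p := fun x => by
    rw [← Real.rpow_mul (abs_nonneg _)]
    congr 1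
    field_simp
  have hJ := (convexOn_rpow hr).map_integral_le (μ := μ) (f := fun x => |f x| ^ (p - 1))
    ((Real.continuous_rpow_const (by positivity)).continuousOn) isClosed_Ici
    (.of_forall fun x => Real.rpow_nonneg (abs_nonneg _) _)
    (integrable_rpow_of_le hf hp1.le (by linarith) h) (by simpa [Function.comp_def, hpow] using h)
  simp_rw [hpow] at hJ
  have h0 : 0 ≤ ∫ x, |f x| ^ (p - 1) ∂μ := integral_nonneg fun x => by positivity
  have hJ' := Real.rpow_le_rpow (by positivity) hJ
    (by rw [sub_nonneg, div_le_one (by linarith)]; exact hp.le : 0 ≤ 1 - 1 / p)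
  rwa [← Real.rpow_mul h0, show p / (p - 1) * (1 - 1 / p) = 1 by field_simp, Real.rpow_one] at hJ'

theorem rpow_sub_one_mul_le {l r p : ℝ} (hl : 0 ≤ l) (hr : 0 ≤ r) (hp : 1 < p) :
    l ^ (p - 1) * r ≤ l ^ p + r ^ p := by
  have hsplit : ∀ x : ℝ, 0 ≤ x → x ^ (p - 1) * x = x ^ p := fun x hx => by
    rw [← Real.rpow_add_one' hx (by linarith), sub_add_cancel]
  have hl' : 0 ≤ l ^ p := by positivity
  have hr' : 0 ≤ r ^ p := by positivity
  rcases le_total l r with h | h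
  · have : l ^ (p - 1) * r ≤ r ^ (p - 1) * r := by gcongr
    linarith [hsplit r hr]
  · have : l ^ (p - 1) * r ≤ l ^ (p - 1) * l := by gcongr
    linarith [hsplit l hl]

theorem integral_abs_gain_le (hL : Measurable L) (hR : Measurable R)
    (hL0 : ∀ᵐ ω ∂P, 0 ≤ L ω) (hR0 : ∀ᵐ ω ∂P, 0 ≤ R ω) (ℓ : E →L[ℝ] ℝ) (μ : Measure E) [IsProbabilityMeasure μ]
    (hμ : Integrable (fun x => |ℓ x|) μ) (hLR : Integrable (fun ω => L ω + R ω) P)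
    (hg : Integrable (fun x => |ℓ x|) (gain P L R μ μ)) :
    ∫ x, |ℓ x| ∂gain P L R μ μ ≤ (∫ ω, (L ω + R ω) ∂P) * ∫ x, |ℓ x| ∂μ := by
  rw [integral_gain hL hR μ μ hg, ← integral_mul_const]
  refine integral_mono_of_nonneg (.of_forall fun ω => integral_nonneg fun z => abs_nonneg _)
    (hLR.mul_const _) ?_
  filter_upwards [hL0, hR0] with ω h1 h2
  have hfst := (hμ.comp_fst μ).const_mul (L ω)
  have hsnd := (hμ.comp_snd μ).const_mul (R ω)
  calc ∫ z : E × E, |ℓ (L ω • z.1 + R ω • z.2)| ∂μ.prod μ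
      ≤ ∫ z : E × E, (L ω * |ℓ z.1| + R ω * |ℓ z.2|) ∂μ.prod μ := by
        refine integral_mono_of_nonneg (.of_forall fun z => abs_nonneg _) (hfst.add hsnd)
          (.of_forall fun z => ?_)
        simp only [map_add, map_smul, smul_eq_mul]
        refine (abs_add_le _ _).trans_eq ?_
        rw [abs_mul, abs_mul, abs_of_nonneg h1, abs_of_nonneg h2]
    _ = (L ω + R ω) * ∫ x, |ℓ x| ∂μ := by
        rw [integral_add hfst hsnd, integral_const_mul, integral_const_mul,
          integral_fun_fst (fun x => |ℓ x|), integral_fun_snd (fun x => |ℓ x|)]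
        simp
        ring

/-- After `add_rpow_le_of_one_le`, independence factorises each cross term into the first moment
times the moment of order `p - 1`, which Jensen bounds by the one of order `p`. The mixed
coefficients `l ^ (p - 1) * r` and `l * r ^ (p - 1)` are each at most `l ^ p + r ^ p`, whence the
factor `2`. -/
theorem integral_rpow_gain_le (hL : Measurable L) (hR : Measurable R)
    (hL0 : ∀ᵐ ω ∂P, 0 ≤ L ω) (hR0 : ∀ᵐ ω ∂P, 0 ≤ R ω) {p : ℝ} (hp : 1 < p) (ℓ : E →L[ℝ] ℝ) (μ : Measure E)
    [IsProbabilityMeasure μ] (hμ : Integrable (fun x => |ℓ x| ^ p) μ)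
    (hLR : Integrable (fun ω => L ω ^ p + R ω ^ p) P)
    (hg : Integrable (fun x => |ℓ x| ^ p) (gain P L R μ μ)) :
    ∫ x, |ℓ x| ^ p ∂gain P L R μ μ ≤ (∫ ω, (L ω ^ p + R ω ^ p) ∂P) *
      (∫ x, |ℓ x| ^ p ∂μ
        + 2 * (p * 2 ^ (p - 1)) * ((∫ x, |ℓ x| ∂μ) * (∫ x, |ℓ x| ^ p ∂μ) ^ (1 - 1 / p))) := by
  have hp0 : 0 < p := by linarith
  set C := p * 2 ^ (p - 1) with hC
  have hC0 : 0 ≤ C := by positivity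
  have hℓ : Measurable ℓ := ℓ.continuous.measurable
  have h1 : Integrable (fun x => |ℓ x|) μ := by
    simpa using integrable_rpow_of_le hℓ zero_le_one hp.le hμ
  have hq : Integrable (fun x => |ℓ x| ^ (p - 1)) μ :=
    integrable_rpow_of_le hℓ (by linarith) (by linarith) hμ
  have hJ := integral_rpow_sub_one_le hℓ hp hμ
  set m := ∫ x, |ℓ x| ^ p ∂μ with hm
  set mq := ∫ x, |ℓ x| ^ (p - 1) ∂μ with hmq
  set m₁ := ∫ x, |ℓ x| ∂μ with hm₁
  have hm₁0 : 0 ≤ m₁ := integral_nonneg fun x => abs_nonneg _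
  have hmq0 : 0 ≤ mq := integral_nonneg fun x => by positivity
  rw [integral_gain hL hR μ μ hg, ← integral_mul_const]
  refine integral_mono_of_nonneg
    (.of_forall fun ω => integral_nonneg fun z => Real.rpow_nonneg (abs_nonneg _) _)
    (hLR.mul_const _) ?_
  filter_upwards [hL0, hR0] with ω hl hr
  set l := L ω
  set r := R ω
  have i1 := (hμ.comp_fst μ).const_mul (l ^ p)
  have i2 := (hμ.comp_snd μ).const_mul (r ^ p)
  have i3 := (hq.mul_prod h1).const_mul (C * (l ^ (p - 1) * r))
  have i4 := (h1.mul_prod hq).const_mul (C * (l * r ^ (p - 1)))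
  have i12 : Integrable (fun z : E × E => l ^ p * |ℓ z.1| ^ p + r ^ p * |ℓ z.2| ^ p)
    (μ.prod μ) := i1.add i2
  have i123 : Integrable (fun z : E × E => l ^ p * |ℓ z.1| ^ p + r ^ p * |ℓ z.2| ^ p
    + C * (l ^ (p - 1) * r) * (|ℓ z.1| ^ (p - 1) * |ℓ z.2|)) (μ.prod μ) := i12.add i3
  calc ∫ z : E × E, |ℓ (l • z.1 + r • z.2)| ^ p ∂μ.prod μ
      ≤ ∫ z : E × E, (l ^ p * |ℓ z.1| ^ p + r ^ p * |ℓ z.2| ^ p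
          + C * (l ^ (p - 1) * r) * (|ℓ z.1| ^ (p - 1) * |ℓ z.2|)
          + C * (l * r ^ (p - 1)) * (|ℓ z.1| * |ℓ z.2| ^ (p - 1))) ∂μ.prod μ := by
        refine integral_mono_of_nonneg (.of_forall fun z => Real.rpow_nonneg (abs_nonneg _) _)
          (((i1.add i2).add i3).add i4) (.of_forall fun z => ?_)
        simp only [map_add, map_smul, smul_eq_mul]
        have ha : |l * ℓ z.1 + r * ℓ z.2| ≤ l * |ℓ z.1| + r * |ℓ z.2| := by
          refine (abs_add_le _ _).trans_eq ?_
          rw [abs_mul, abs_mul, abs_of_nonneg hl, abs_of_nonneg hr]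
        refine (Real.rpow_le_rpow (abs_nonneg _) ha hp0.le).trans ?_
        refine (add_rpow_le_of_one_le (by positivity) (by positivity) hp.le).trans_eq ?_
        rw [Real.mul_rpow hl (abs_nonneg _), Real.mul_rpow hr (abs_nonneg _),
          Real.mul_rpow hl (abs_nonneg _), Real.mul_rpow hr (abs_nonneg _)]
        ring
    _ = l ^ p * m + r ^ p * m + C * (l ^ (p - 1) * r) * (mq * m₁)
          + C * (l * r ^ (p - 1)) * (m₁ * mq) := by
        rw [integral_add i123 i4, integral_add i12 i3, integral_add i1 i2,
          integral_const_mul, integral_const_mul, integral_const_mul, integral_const_mul,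
          integral_fun_fst (fun x => |ℓ x| ^ p),
          integral_fun_snd (fun x => |ℓ x| ^ p),
          integral_prod_mul (fun x => |ℓ x| ^ (p - 1)) (fun x => |ℓ x|),
          integral_prod_mul (fun x => |ℓ x|) (fun x => |ℓ x| ^ (p - 1))]
        simp [hm, hmq, hm₁]
    _ = (l ^ p + r ^ p) * m + C * (l ^ (p - 1) * r + r ^ (p - 1) * l) * (m₁ * mq) := by ring
    _ ≤ (l ^ p + r ^ p) * m
          + C * ((l ^ p + r ^ p) + (r ^ p + l ^ p)) * (m₁ * m ^ (1 - 1 / p)) := by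
        gcongr
        · exact rpow_sub_one_mul_le hl hr hp
        · exact rpow_sub_one_mul_le hr hl hp
    _ = (l ^ p + r ^ p) * (m + 2 * C * (m₁ * m ^ (1 - 1 / p))) := by ring

/-- Decay of the moment of order `p` of a one-dimensional marginal of the Wild expansion. -/
theorem exists_moment_wildFlow_le (hL : Measurable L) (hR : Measurable R)
    (hL0 : ∀ᵐ ω ∂P, 0 ≤ L ω) (hR0 : ∀ᵐ ω ∂P, 0 ≤ R ω) {p : ℝ} (hp : 1 < p)
    (hLR1 : Integrable (fun ω => L ω + R ω) P) (hLp : Integrable (fun ω => L ω ^ p) P)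
    (hRp : Integrable (fun ω => R ω ^ p) P) (ℓ : E →L[ℝ] ℝ) (π : Measure E)
    [IsProbabilityMeasure π] (hπ : Integrable (fun x => |ℓ x| ^ p) π) :
    ∃ C : ℝ, 0 < C ∧
      (((∫ ω, (L ω ^ p + R ω ^ p) ∂P) - 1) / p ≠ (∫ ω, (L ω + R ω) ∂P) - 1 → ∀ t, 0 ≤ t →
        (∫ x, |ℓ x| ^ p ∂wildFlow P L R π t) ^ (1 / p) ≤ C * Real.exp
          (max ((∫ ω, (L ω + R ω) ∂P) - 1) (((∫ ω, (L ω ^ p + R ω ^ p) ∂P) - 1) / p) * t)) ∧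
      (((∫ ω, (L ω ^ p + R ω ^ p) ∂P) - 1) / p = (∫ ω, (L ω + R ω) ∂P) - 1 → ∀ t, 0 ≤ t →
        (∫ x, |ℓ x| ^ p ∂wildFlow P L R π t) ^ (1 / p)
          ≤ C * max 1 t * Real.exp (((∫ ω, (L ω + R ω) ∂P) - 1) * t)) := by
  have hℓ : Measurable ℓ := ℓ.continuous.measurable
  have hLp' : Integrable (fun ω => |L ω| ^ p) P :=
    hLp.congr (by filter_upwards [hL0] with ω h; rw [abs_of_nonneg h])
  have hRp' : Integrable (fun ω => |R ω| ^ p) P :=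
    hRp.congr (by filter_upwards [hR0] with ω h; rw [abs_of_nonneg h])
  have hπ1 : Integrable (fun x => |ℓ x| ^ (1 : ℝ)) π := integrable_rpow_of_le hℓ zero_le_one hp.le hπ
  obtain ⟨c, hc⟩ := exists_gainBounded_rpow hL hR ℓ hp.le hLp' hRp'
  obtain ⟨c₁, hc₁⟩ := exists_gainBounded_rpow hL hR ℓ le_rfl
    (integrable_rpow_of_le hL zero_le_one hp.le hLp')
    (integrable_rpow_of_le hR zero_le_one hp.le hRp')
  have hmeas : ∀ q : ℝ, Measurable fun x => |ℓ x| ^ q := fun q => by fun_prop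
  have hM0 : 0 ≤ ∫ ω, (L ω ^ p + R ω ^ p) ∂P := integral_nonneg_of_ae (by
    filter_upwards [hL0, hR0] with ω h1 h2
    exact add_nonneg (Real.rpow_nonneg h1 _) (Real.rpow_nonneg h2 _))
  refine exists_rpow_inv_le (K := (∫ ω, (L ω ^ p + R ω ^ p) ∂P) * (2 * (p * 2 ^ (p - 1)))) hp
    (by positivity)
    (fun t ht => hasDerivWithinAt_integral_wildFlow hL hR (hmeas p) hc hπ.2 ht)
    (fun t ht => hasDerivWithinAt_integral_wildFlow hL hR (hmeas 1) hc₁ hπ1.2 ht)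
    (fun t ht => integral_nonneg fun x => Real.rpow_nonneg (abs_nonneg _) _)
    (fun t ht => integral_nonneg fun x => Real.rpow_nonneg (abs_nonneg _) _)
    (fun t ht => ?_) (fun t ht => ?_)
  · have := isProbabilityMeasure_wildFlow (P := P) hL hR π ht
    have h1 := integrable_wildFlow hL hR (hmeas 1) hc₁ hπ1.2 ht
    have h2 := integrable_gain_wildFlow hL hR (hmeas 1) hc₁ hπ1.2 ht
    simp only [Real.rpow_one] at h1 h2 ⊢
    have := integral_abs_gain_le hL hR hL0 hR0 ℓ _ h1 hLR1 h2
    linarith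
  · have := isProbabilityMeasure_wildFlow (P := P) hL hR π ht
    have h1 := integrable_wildFlow hL hR (hmeas p) hc hπ.2 ht
    have h2 := integrable_gain_wildFlow hL hR (hmeas p) hc hπ.2 ht
    have := integral_rpow_gain_le hL hR hL0 hR0 hp ℓ _ h1 (hLp.add hRp) h2
    simp only [Real.rpow_one]
    linarith

end Moments

/-! ### Stationarity of the steady state -/

section SteadyState

variable {P : Measure Ω} [IsProbabilityMeasure P] {L R : Ω → ℝ}

theorem power_eq_rpow {s : ℝ} (hs : s ≠ 0) (x : ℝ) : power x s = x ^ s := by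
  unfold power
  split_ifs with h
  · rw [h, Real.zero_rpow hs]
  · rfl

theorem HasTails.nonneg {μ₀ : Measure ℝ} {α cplus cminus : ℝ} (h : HasTails μ₀ α cplus cminus) :
    0 ≤ cplus ∧ 0 ≤ cminus := by
  constructor
  · refine ge_of_tendsto h.1 ?_
    filter_upwards [eventually_ge_atTop 0] with x hx
    exact mul_nonneg (Real.rpow_nonneg hx _) (by linarith [cdf_le_one μ₀ x])
  · exact ge_of_tendsto h.2 (.of_forall fun x =>
      mul_nonneg (Real.rpow_nonneg (abs_nonneg _) _) (cdf_nonneg μ₀ x))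

theorem HasTails.stableScale_nonneg {μ₀ : Measure ℝ} {α cplus cminus : ℝ}
    (h : HasTails μ₀ α cplus cminus) (h0 : 0 < α) (h2 : α ≤ 2) :
    0 ≤ stableScale α cplus cminus := by
  obtain ⟨hp, hm⟩ := h.nonneg
  have hsin : 0 ≤ Real.sin (Real.pi * α / 2) :=
    Real.sin_nonneg_of_nonneg_of_le_pi (by positivity) (by nlinarith [Real.pi_pos])
  have hG := Real.Gamma_pos_of_pos h0
  unfold stableScale
  positivity

/-- As an identity of measures, the fixed-point equation can be tested against the complex functions
`stableExp`, which are not characters of `m`. -/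
theorem IsMixingLaw.gain_eq (hL : Measurable L) (hR : Measurable R) {α : ℝ} (hα : α ≠ 0)
    {ν : Measure ℝ} (hν : IsMixingLaw P L R α ν) :
    gain P (fun ω => L ω ^ α) (fun ω => R ω ^ α) ν ν = ν := by
  have := hν.isProbabilityMeasure
  have hLα : Measurable fun ω => L ω ^ α := hL.pow_const α
  have hRα : Measurable fun ω => R ω ^ α := hR.pow_const α
  have := isProbabilityMeasure_gain (P := P) hLα hRα ν ν
  refine Measure.ext_of_charFun (funext fun ξ => ?_)
  have h := charFun_gain_map (P := P) hLα hRα (ContinuousLinearMap.id ℝ ℝ) ν ν ξ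
  simp only [ContinuousLinearMap.coe_id', Measure.map_id] at h
  rw [h, hν.fixed ξ]
  simp only [gainHat, power_eq_rpow hα]

/-- The exponential `exp (-λ m |ξ| ^ α (1 - i b sign ξ))`. -/
def stableExp (lam b α ξ m : ℝ) : ℂ :=
  Complex.exp (-((lam * m * |ξ| ^ α : ℝ) : ℂ) * (1 - Complex.I * ((b * Real.sign ξ : ℝ) : ℂ)))

theorem measurable_stableExp (lam b α ξ : ℝ) : Measurable (stableExp lam b α ξ) := by
  unfold stableExp
  fun_prop

theorem norm_stableExp_le_one {lam m : ℝ} (b α ξ : ℝ) (hlam : 0 ≤ lam) (hm : 0 ≤ m) :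
    ‖stableExp lam b α ξ m‖ ≤ 1 := by
  rw [stableExp, Complex.norm_exp, Real.exp_le_one_iff]
  simp
  positivity

/-- Homogeneity of degree `α` of the stable exponent: together with `stableExp_add` it carries the
fixed-point equation of the mixing law over to the mixture. -/
theorem stableExp_scale (lam b ξ m : ℝ) {α x : ℝ} (hα : α ≠ 0) (hx : 0 ≤ x) :
    stableExp lam b α ξ (x ^ α * m) = stableExp lam b α (x * ξ) m := by
  rcases hx.eq_or_lt with rfl | hx
  · simp [stableExp, Real.zero_rpow hα]
  · have hs : Real.sign (x * ξ) = Real.sign ξ := by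
      rcases lt_trichotomy ξ 0 with h | rfl | h
      · rw [Real.sign_of_neg h, Real.sign_of_neg (mul_neg_of_pos_of_neg hx h)]
      · rw [mul_zero]
      · rw [Real.sign_of_pos h, Real.sign_of_pos (mul_pos hx h)]
    rw [stableExp, stableExp, hs, abs_mul, abs_of_pos hx, Real.mul_rpow hx.le (abs_nonneg _)]
    ring_nf

theorem stableExp_add (lam b α ξ m n : ℝ) :
    stableExp lam b α ξ (m + n) = stableExp lam b α ξ m * stableExp lam b α ξ n := by
  rw [stableExp, stableExp, stableExp, ← Complex.exp_add]
  push_cast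
  ring_nf

/-- The steady state is a stationary weak solution. -/
theorem IsSteadyState.isWeakSolution (hL : Measurable L) (hR : Measurable R)
    (hL0 : ∀ᵐ ω ∂P, 0 ≤ L ω) (hR0 : ∀ᵐ ω ∂P, 0 ≤ R ω) {α cplus cminus : ℝ} (hα : α ≠ 0)
    (hscale : 0 ≤ stableScale α cplus cminus) {μinf : Measure ℝ}
    (h : IsSteadyState P L R α cplus cminus μinf) :
    IsWeakSolution P L R μinf fun _ => μinf := by
  obtain ⟨hprob, ν, hν, hchar⟩ := h
  have := hν.isProbabilityMeasure
  set lam := stableScale α cplus cminus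
  set b := stableSkewness cplus cminus * Real.tan (Real.pi * α / 2)
  have hchar' : ∀ ξ, charFun μinf ξ = ∫ m, stableExp lam b α ξ m ∂ν := hchar
  have hpos : ∀ᵐ m ∂ν, 0 ≤ m := by
    rw [ae_iff]
    simpa [Set.Iio] using hν.nonneg
  have hfix := hν.gain_eq hL hR hα
  have hstat : ∀ ξ, gainHat P L R (charFun μinf) (charFun μinf) ξ = charFun μinf ξ := by
    intro ξ
    have hint : Integrable (stableExp lam b α ξ) ν :=
      Integrable.of_bound (C := 1) (measurable_stableExp _ _ _ _).aestronglyMeasurable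
        (hpos.mono fun m hm => norm_stableExp_le_one _ _ _ hscale hm)
    rw [hchar' ξ]
    conv_rhs => rw [← hfix]
    rw [integral_gain (hL.pow_const α) (hR.pow_const α) ν ν (by rwa [hfix])]
    refine integral_congr_ae ?_
    filter_upwards [hL0, hR0] with ω hl hr
    simp only [smul_eq_mul, stableExp_add, stableExp_scale _ _ _ _ hα hl,
      stableExp_scale _ _ _ _ hα hr]
    rw [hchar', hchar', ← integral_prod_mul]
  refine ⟨fun _ _ => hprob, rfl, fun ξ => continuousWithinAt_const, fun t _ ξ => ?_⟩
  rw [hstat, sub_self]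
  exact hasDerivAt_const _ _

end SteadyState

/-! ### Spectral function and couplings -/

section Spectral

variable {P : Measure Ω} [IsProbabilityMeasure P] {L R : Ω → ℝ}

theorem integrable_of_powerMoment_lt_top (hL : Measurable L) (hR : Measurable R)
    (hL0 : ∀ᵐ ω ∂P, 0 ≤ L ω) (hR0 : ∀ᵐ ω ∂P, 0 ≤ R ω) {q : ℝ} (hq : q ≠ 0)
    (h : powerMoment P L R q < ∞) :
    Integrable (fun ω => L ω ^ q) P ∧ Integrable (fun ω => R ω ^ q) P := by
  have hnn : ∀ᵐ ω ∂P, 0 ≤ L ω ^ q ∧ 0 ≤ R ω ^ q := by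
    filter_upwards [hL0, hR0] with ω h1 h2
    exact ⟨Real.rpow_nonneg h1 _, Real.rpow_nonneg h2 _⟩
  have hsum : Integrable (fun ω => L ω ^ q + R ω ^ q) P := by
    refine ⟨((hL.pow_const q).add (hR.pow_const q)).aestronglyMeasurable, ?_⟩
    rw [hasFiniteIntegral_iff_ofReal (hnn.mono fun ω h => add_nonneg h.1 h.2)]
    simpa only [powerMoment, power_eq_rpow hq] using h
  refine ⟨hsum.mono' (hL.pow_const q).aestronglyMeasurable ?_,
    hsum.mono' (hR.pow_const q).aestronglyMeasurable ?_⟩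
  · filter_upwards [hnn] with ω h
    rw [Real.norm_of_nonneg h.1]
    linarith
  · filter_upwards [hnn] with ω h
    rw [Real.norm_of_nonneg h.2]
    linarith

theorem powerMoment_eq_ofReal_integral (hL0 : ∀ᵐ ω ∂P, 0 ≤ L ω) (hR0 : ∀ᵐ ω ∂P, 0 ≤ R ω) {q : ℝ}
    (hq : q ≠ 0) (hLq : Integrable (fun ω => L ω ^ q) P) (hRq : Integrable (fun ω => R ω ^ q) P) :
    powerMoment P L R q = ENNReal.ofReal (∫ ω, (L ω ^ q + R ω ^ q) ∂P) := by
  have hsum : Integrable (fun ω => L ω ^ q + R ω ^ q) P := hLq.add hRq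
  rw [ofReal_integral_eq_lintegral_ofReal hsum]
  · simp only [powerMoment, power_eq_rpow hq]
  · filter_upwards [hL0, hR0] with ω h1 h2
    exact add_nonneg (Real.rpow_nonneg h1 _) (Real.rpow_nonneg h2 _)

theorem spectralPhi_eq_coe (hL0 : ∀ᵐ ω ∂P, 0 ≤ L ω) (hR0 : ∀ᵐ ω ∂P, 0 ≤ R ω) {q : ℝ}
    (hq : q ≠ 0) (hLq : Integrable (fun ω => L ω ^ q) P) (hRq : Integrable (fun ω => R ω ^ q) P) :
    spectralPhi P L R q = ((((∫ ω, (L ω ^ q + R ω ^ q) ∂P) - 1) / q : ℝ) : EReal) := by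
  have h0 : 0 ≤ ∫ ω, (L ω ^ q + R ω ^ q) ∂P := integral_nonneg_of_ae (by
    filter_upwards [hL0, hR0] with ω h1 h2
    exact add_nonneg (Real.rpow_nonneg h1 _) (Real.rpow_nonneg h2 _))
  rw [spectralPhi, spectralS, powerMoment_eq_ofReal_integral hL0 hR0 hq hLq hRq,
    EReal.coe_ennreal_ofReal, max_eq_left h0, EReal.coe_div, EReal.coe_sub, EReal.coe_one]

/-- Weighted arithmetic-geometric mean inequality, with the weights that express `1` as a convex
combination of `α` and `p`. -/
theorem le_interpolation_rpow {x α p : ℝ} (hx : 0 ≤ x) (hα : α < 1) (hp : 1 < p) :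
    x ≤ (p - 1) / (p - α) * x ^ α + (1 - α) / (p - α) * x ^ p := by
  have hd : 0 < p - α := by linarith
  have h := Real.geom_mean_le_arith_mean2_weighted (w₁ := (p - 1) / (p - α))
    (w₂ := (1 - α) / (p - α)) (div_nonneg (by linarith) hd.le) (div_nonneg (by linarith) hd.le)
    (Real.rpow_nonneg hx α) (Real.rpow_nonneg hx p) (by field_simp; ring)
  rw [← Real.rpow_mul hx, ← Real.rpow_mul hx] at h
  have hexp : α * ((p - 1) / (p - α)) + p * ((1 - α) / (p - α)) = 1 := by field_simp; ring
  rwa [← Real.rpow_add' hx (by rw [hexp]; exact one_ne_zero), hexp, Real.rpow_one] at h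

/-- Interpolating between the moment of order `α`, equal to `1`, and the one of order `p`, less than
`1` and of positive weight since `α < 1`, gives the decay `S(1) < 0` of the first moment. -/
theorem AssumptionH0.integral_add_lt_one {α p : ℝ} (h : AssumptionH0 P L R α p) (hα : α < 1)
    (hp : 1 < p) : ∫ ω, (L ω + R ω) ∂P < 1 := by
  have hα0 := h.alpha_pos
  have hd : 0 < p - α := by linarith
  have hL0 := h.nonneg_left
  have hR0 := h.nonneg_right
  obtain ⟨hLα, hRα⟩ := integrable_of_powerMoment_lt_top h.measurable_left h.measurable_right
    hL0 hR0 hα0.ne' (h.moment_alpha.trans_lt ENNReal.one_lt_top)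
  obtain ⟨hLp, hRp⟩ := integrable_of_powerMoment_lt_top h.measurable_left h.measurable_right
    hL0 hR0 h.p_pos.ne' (h.moment_p.trans ENNReal.one_lt_top)
  have hMα := h.moment_alpha
  have hMp := h.moment_p
  rw [powerMoment_eq_ofReal_integral hL0 hR0 hα0.ne' hLα hRα, ENNReal.ofReal_eq_one] at hMα
  rw [powerMoment_eq_ofReal_integral hL0 hR0 h.p_pos.ne' hLp hRp, ENNReal.ofReal_lt_one] at hMp
  have hiα : Integrable (fun ω => (p - 1) / (p - α) * (L ω ^ α + R ω ^ α)) P :=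
    (hLα.add hRα).const_mul _
  have hip : Integrable (fun ω => (1 - α) / (p - α) * (L ω ^ p + R ω ^ p)) P :=
    (hLp.add hRp).const_mul _
  have hle : ∫ ω, (L ω + R ω) ∂P ≤ ∫ ω, ((p - 1) / (p - α) * (L ω ^ α + R ω ^ α)
      + (1 - α) / (p - α) * (L ω ^ p + R ω ^ p)) ∂P := by
    refine integral_mono_of_nonneg ?_ (hiα.add hip) ?_
    · filter_upwards [hL0, hR0] with ω h1 h2 using add_nonneg h1 h2
    · filter_upwards [hL0, hR0] with ω h1 h2
      linarith [le_interpolation_rpow h1 hα hp, le_interpolation_rpow h2 hα hp]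
  refine hle.trans_lt ?_
  rw [integral_add hiα hip, integral_const_mul, integral_const_mul, hMα]
  have h1 : (1 - α) / (p - α) * ∫ ω, (L ω ^ p + R ω ^ p) ∂P < (1 - α) / (p - α) * 1 :=
    mul_lt_mul_of_pos_left hMp (div_pos (by linarith) hd)
  have h2 : (p - 1) / (p - α) * 1 + (1 - α) / (p - α) * 1 = 1 := by field_simp; ring
  linarith

theorem wasserstein_le_of_coupling {p : ℝ} (hp : 1 ≤ p) {μ₁ μ₂ : Measure ℝ} (m : Measure (ℝ × ℝ))
    [IsProbabilityMeasure m] (h₁ : m.map Prod.fst = μ₁) (h₂ : m.map Prod.snd = μ₂)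
    (hm : Integrable (fun z : ℝ × ℝ => |z.1 - z.2| ^ p) m) :
    wasserstein p μ₁ μ₂ ≤ ENNReal.ofReal ((∫ z, |z.1 - z.2| ^ p ∂m) ^ (1 / p)) := by
  have hp0 : 0 < p := by linarith
  refine (iInf₂_le m ⟨inferInstance, h₁, h₂⟩).trans_eq ?_
  rw [min_eq_right (by rwa [div_le_one hp0]), ← ENNReal.ofReal_rpow_of_nonneg
    (integral_nonneg fun z => Real.rpow_nonneg (abs_nonneg _) _) (by positivity),
    ofReal_integral_eq_lintegral_ofReal hm
      (.of_forall fun z => Real.rpow_nonneg (abs_nonneg _) _)]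

theorem exists_coupling_of_wasserstein_lt_top {p : ℝ} (hp : 0 < p) {μ₁ μ₂ : Measure ℝ}
    (h : wasserstein p μ₁ μ₂ < ∞) :
    ∃ m : Measure (ℝ × ℝ), IsProbabilityMeasure m ∧ m.map Prod.fst = μ₁ ∧ m.map Prod.snd = μ₂ ∧
      Integrable (fun z : ℝ × ℝ => |z.1 - z.2| ^ p) m := by
  simp only [wasserstein, iInf_lt_iff] at h
  obtain ⟨m, ⟨hm, h₁, h₂⟩, hfin⟩ := h
  refine ⟨m, hm, h₁, h₂, (by fun_prop : Measurable _).aestronglyMeasurable, ?_⟩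
  rw [hasFiniteIntegral_iff_ofReal (.of_forall fun z => Real.rpow_nonneg (abs_nonneg _) _)]
  rwa [ENNReal.rpow_lt_top_iff_of_pos (by positivity)] at hfin

end Spectral

end GenKac

end

/-! ### Convergence to the steady state -/

theorem theorem3p3 {Ω : Type*} [MeasurableSpace Ω] (P : Measure Ω) [IsProbabilityMeasure P]
    (L R : Ω → ℝ) (α p : ℝ) (hH0 : GenKac.AssumptionH0 P L R α p) (hα : α < 1) (hp : 1 < p)
    (μ₀ : Measure ℝ) [IsProbabilityMeasure μ₀] (cplus cminus : ℝ)
    (htails : GenKac.HasTails μ₀ α cplus cminus)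
    (μinf : Measure ℝ) (hμinf : GenKac.IsSteadyState P L R α cplus cminus μinf)
    (hfin : GenKac.wasserstein p μ₀ μinf < ∞) :
    ∃ C : ℝ, 0 < C ∧ ∀ μ : ℝ → Measure ℝ, GenKac.IsWeakSolution P L R μ₀ μ →
      (GenKac.spectralPhi P L R p ≠ GenKac.spectralPhi P L R 1 →
        ∀ t : ℝ, 0 ≤ t → GenKac.wasserstein p (μ t) μinf ≤
          ENNReal.ofReal (C * Real.exp (-t * |(GenKac.K₁ P L R p).toReal|))) ∧
      (GenKac.spectralPhi P L R p = GenKac.spectralPhi P L R 1 →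
        ∀ t : ℝ, 0 ≤ t → GenKac.wasserstein p (μ t) μinf ≤
          ENNReal.ofReal (C * max 1 t * Real.exp (-t * |(GenKac.K₁ P L R p).toReal|))) := by
  have hL := hH0.measurable_left
  have hR := hH0.measurable_right
  have hL0 := hH0.nonneg_left
  have hR0 := hH0.nonneg_right
  have hp0 := hH0.p_pos
  obtain ⟨hLp, hRp⟩ := GenKac.integrable_of_powerMoment_lt_top hL hR hL0 hR0 hp0.ne'
    (hH0.moment_p.trans ENNReal.one_lt_top)
  have integrable_of_rpow : ∀ {X : Ω → ℝ}, Measurable X → (∀ᵐ ω ∂P, 0 ≤ X ω) →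
      Integrable (fun ω => X ω ^ p) P → Integrable X P := by
    intro X hX hX0 hXp
    have h := GenKac.integrable_rpow_of_le (s := 1) hX zero_le_one hp.le
      (hXp.congr (by filter_upwards [hX0] with ω h; rw [abs_of_nonneg h]))
    exact h.congr (by filter_upwards [hX0] with ω h; rw [abs_of_nonneg h, Real.rpow_one])
  have hL1 := integrable_of_rpow hL hL0 hLp
  have hR1 := integrable_of_rpow hR hR0 hRp
  have hphi1 := GenKac.spectralPhi_eq_coe hL0 hR0 one_ne_zero (by simpa using hL1)
    (by simpa using hR1)
  have hphip := GenKac.spectralPhi_eq_coe hL0 hR0 hp0.ne' hLp hRp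
  simp only [Real.rpow_one, div_one] at hphi1
  have hMp := hH0.moment_p
  rw [GenKac.powerMoment_eq_ofReal_integral hL0 hR0 hp0.ne' hLp hRp, ENNReal.ofReal_lt_one] at hMp
  have hM1 := hH0.integral_add_lt_one hα hp
  obtain ⟨m, hm, hm₁, hm₂, hmint⟩ := GenKac.exists_coupling_of_wasserstein_lt_top hp0 hfin
  -- The functional `x - y`: its moment of order `p` under a coupling is the transport cost.
  set ℓ : ℝ × ℝ →L[ℝ] ℝ := ContinuousLinearMap.fst ℝ ℝ ℝ - ContinuousLinearMap.snd ℝ ℝ ℝ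
  obtain ⟨C, hC, hne, heq⟩ := GenKac.exists_moment_wildFlow_le hL hR hL0 hR0 hp (hL1.add hR1)
    hLp hRp ℓ m hmint
  set s₁ := (∫ ω, (L ω + R ω) ∂P) - 1 with hs₁
  set sp := ((∫ ω, (L ω ^ p + R ω ^ p) ∂P) - 1) / p with hsp
  have hs₁0 : s₁ < 0 := by linarith
  have hsp0 : sp < 0 := div_neg_of_neg_of_pos (by linarith) hp0
  have hK : |(GenKac.K₁ P L R p).toReal| = -max s₁ sp := by
    rw [GenKac.K₁, hphi1, hphip, ← EReal.coe_strictMono.monotone.map_max, EReal.toReal_coe,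
      abs_of_neg (max_lt hs₁0 hsp0)]
  have hscale := htails.stableScale_nonneg hH0.alpha_pos hH0.alpha_le_two
  have hstat := hμinf.isWeakSolution hL hR hL0 hR0 hH0.alpha_pos.ne' hscale
  -- `C` comes from the flow started at `m`, so it is fixed before the solution and the time.
  refine ⟨C, hC, fun μ hμ => ?_⟩
  have hW : ∀ t, 0 ≤ t → GenKac.wasserstein p (μ t) μinf
      ≤ ENNReal.ofReal ((∫ z, |ℓ z| ^ p ∂GenKac.wildFlow P L R m t) ^ (1 / p)) := by
    intro t ht
    have h₁ := GenKac.isWeakSolution_map_wildFlow (P := P) hL hR (ContinuousLinearMap.fst ℝ ℝ ℝ) m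
    have h₂ := GenKac.isWeakSolution_map_wildFlow (P := P) hL hR (ContinuousLinearMap.snd ℝ ℝ ℝ) m
    rw [ContinuousLinearMap.coe_fst', hm₁] at h₁
    rw [ContinuousLinearMap.coe_snd', hm₂] at h₂
    have := GenKac.isProbabilityMeasure_wildFlow (P := P) hL hR m ht
    refine GenKac.wasserstein_le_of_coupling hp.le (GenKac.wildFlow P L R m t)
      (h₁.unique hL hR hμ ht) (h₂.unique hL hR hstat ht) ?_
    have habs : ∀ {X : Ω → ℝ}, (∀ᵐ ω ∂P, 0 ≤ X ω) → Integrable (fun ω => X ω ^ p) P →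
        Integrable (fun ω => |X ω| ^ p) P := fun hX0 hXp =>
      hXp.congr (by filter_upwards [hX0] with ω h; rw [abs_of_nonneg h])
    obtain ⟨c, hc⟩ := GenKac.exists_gainBounded_rpow hL hR ℓ hp.le (habs hL0 hLp) (habs hR0 hRp)
    exact GenKac.integrable_wildFlow (g := fun z => |ℓ z| ^ p) hL hR (by fun_prop) hc hmint.2 ht
  rw [hphi1, hphip, hK, Ne, EReal.coe_eq_coe_iff]
  refine ⟨fun h t ht => ?_, fun h t ht => ?_⟩
  · refine (hW t ht).trans (ENNReal.ofReal_le_ofReal ?_)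
    rw [show -t * -max s₁ sp = max s₁ sp * t by ring]
    exact hne h t ht
  · refine (hW t ht).trans (ENNReal.ofReal_le_ofReal ?_)
    rw [h, max_self, show -t * -s₁ = s₁ * t by ring]
    exact heq h t ht
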